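/- Let $\mathbf B$ be a real separable Banach space, let $0<q\le p<1$, and let $X_1,X_2,\dots$ be i.i.d. $\mathbf B$-valued random variables with the same distribution as a $\mathbf B$-valued random variable $X$. Put $S_n=\sum_{k=1}^n X_k$, and for $n\ge 1$ let $$u_n=\inf\left\{t:\ \mathbb P(\|X\|\le t)>1-\tfrac1n\right\}$$ be the quantile of order $1-1/n$ of $\|X\|$. One says that $X\in\operatorname{SLLN}(p,q)$ if $$\sum_{n=1}^\infty \frac1n\left(\frac{\|S_n\|}{n^{1/p}}\right)^q<\infty\quad\text{almost surely.}$$ Then $X\in\operatorname{SLLN}(p,q)$ if and only if $$\begin{cases}\displaystyle\int_0^\infty \mathbb P^{q/p}\left(\|X\|^q>t\right)\,dt<\infty & \text{if } q<p,\\[2mm] \displaystyle\mathbb E\left(\|X\|^p\right)<\infty\ \text{ and }\ \sum_{n=1}^\infty\frac{\mathbb E\left(\|X\|^p\,\mathbf 1\left(\min\{u_n^p,n\}<\|X\|^p\le n\right)\right)}{n}<\infty & \text{if } q=p.\end{cases}$$ -/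

import Mathlib

open MeasureTheory ProbabilityTheory

/-- The quantile of order `α` of a real random variable `Y`:
`inf {t : P(Y ≤ t) > α}`. -/
noncomputable def quantile {Ω : Type*} [MeasurableSpace Ω] (μ : Measure Ω)
    (Y : Ω → ℝ) (α : ℝ) : ℝ :=
  sInf {t : ℝ | α < μ.real {ω | Y ω ≤ t}}

/-- The partial sum of the first `n` terms of the sequence `Xs 0, Xs 1, …`. -/
def partialSum {Ω B : Type*} [AddCommMonoid B] (Xs : ℕ → Ω → B) (n : ℕ) (ω : Ω) : B :=
  ∑ k ∈ Finset.range n, Xs k ω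

/-- The `(p, q)`-type strong law of large numbers for the sequence `Xs`:
`∑_{n ≥ 1} (1 / n) * (‖S_n‖ / n ^ (1 / p)) ^ q < ∞` almost surely, where `S_n` is the sum of
the first `n` variables (the index `n` of the series is shifted by one). -/
def PQTypeSLLN {Ω B : Type*} [MeasurableSpace Ω] [NormedAddCommGroup B]
    (μ : Measure Ω) (Xs : ℕ → Ω → B) (p q : ℝ) : Prop :=
  ∀ᵐ ω ∂μ, Summable fun n : ℕ =>
    1 / ((n + 1 : ℕ) : ℝ) *
      (‖partialSum Xs (n + 1) ω‖ / ((n + 1 : ℕ) : ℝ) ^ (1 / p)) ^ q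

/-- `u_n`, the quantile of order `1 - 1 / n` of `‖X‖` (meant for `n ≥ 1`). -/
noncomputable def normQuantile {Ω B : Type*} [MeasurableSpace Ω] [NormedAddCommGroup B]
    (μ : Measure Ω) (X : Ω → B) (n : ℕ) : ℝ :=
  quantile μ (fun ω => ‖X ω‖) (1 - 1 / (n : ℝ))

/-- `E(‖X‖^p 1(min{u_n^p, n} < ‖X‖^p ≤ n))`; the integrand takes values in `[0, n]`. -/
noncomputable def truncatedMoment {Ω B : Type*} [MeasurableSpace Ω] [NormedAddCommGroup B]
    (μ : Measure Ω) (X : Ω → B) (p : ℝ) (n : ℕ) : ℝ :=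
  ∫ ω, {ω | min (normQuantile μ X n ^ p) (n : ℝ) < ‖X ω‖ ^ p ∧ ‖X ω‖ ^ p ≤ (n : ℝ)}.indicator
    (fun ω => ‖X ω‖ ^ p) ω ∂μ

/-! Put `α = q / p`. The property says that `F = ∑ n^{-(1+α)} ‖S_n‖^q` is finite almost surely.
Since `q ≤ 1`, `‖·‖^q` is subadditive, which replaces symmetrization and centering throughout.

Necessity. `F` is bounded on an event of probability close to one, and the layer-cake formula there
bounds a weighted integral of the tails of `‖S_n‖^q`. These tails are bounded below by the single
big jump principle (`min_one_card_mul_le_measureReal_norm_partialSum_gt`): `P(‖S_n‖^q > s)` is at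
least a constant times `min(1, n P(‖X‖^q > 3s))` for large `s`. If `q < p`, only the `n` with `n
P(‖X‖^q > t) ≥ 1` are kept; their weights sum to at least a constant times `P(‖X‖^q > t)^α`, and the
fixed probability of the bad event is absorbed. If `q = p`, small probabilities matter and this
absorption is too costly. Instead the jump is confined to indices in `[n, 2n)` and to sizes `‖X_k‖^p
≤ n`; such a jump changes `F` by at most `2`, so the bounded event survives it. This yields `∑
n^{-2} ∫ min(1, n P(t < ‖X‖^p ≤ n)) dt < ∞` (`lintegral_tsum_cappedTail_lt_top`), from which both
conditions are read off.

Sufficiency. `‖S_n‖` is bounded by the sum of the norms, cut at the quantiles `v_j = u_{2^j}`. The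
tail integral controls `∑ 2^{-αj} v_j^q`. Norms below `v_j` are handled shell by shell with Jensen's
inequality, and the resulting geometric series converges because `q < α`, that is, `p < 1`
(`tsum_lintegral_truncNormSum_le_lt_top`). Norms above `v_j` are handled by subadditivity, with a
series that converges because `α < 1` (`tsum_lintegral_truncNormSum_gt_lt_top`). When `q = p`, `α =
1` and the last step fails: norms with `u_n^p < ‖x‖^p ≤ n` contribute exactly the second condition,
and those with `‖x‖^p > n` eventually vanish by Borel–Cantelli. -/

/-- The weight `n ^ (-(1 + α))` of the `n`-th partial sum (index shifted by one). -/
noncomputable def slWeight (α : ℝ) (n : ℕ) : ENNReal :=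
  ENNReal.ofReal (((n + 1 : ℕ) : ℝ) ^ (-(1 + α)))

/-! ### Subadditivity of powers and the series in `ENNReal` -/

theorem norm_add_rpow_le {B : Type*} [NormedAddCommGroup B] {q : ℝ} (hq : 0 ≤ q) (hq1 : q ≤ 1)
    (x y : B) : ‖x + y‖ ^ q ≤ ‖x‖ ^ q + ‖y‖ ^ q :=
  (Real.rpow_le_rpow (norm_nonneg _) (norm_add_le x y) hq).trans
    (Real.rpow_add_le_add_rpow (norm_nonneg _) (norm_nonneg _) hq hq1)

theorem norm_sub_rpow_le {B : Type*} [NormedAddCommGroup B] {q : ℝ} (hq : 0 ≤ q) (hq1 : q ≤ 1)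
    (x y : B) : ‖x - y‖ ^ q ≤ ‖x‖ ^ q + ‖y‖ ^ q := by
  simpa [sub_eq_add_neg] using norm_add_rpow_le hq hq1 x (-y)

theorem slWeight_mul_ofReal {α : ℝ} (n : ℕ) (x : ℝ) :
    slWeight α n * ENNReal.ofReal x =
      ENNReal.ofReal (((n + 1 : ℕ) : ℝ) ^ (-(1 + α)) * x) := by
  rw [slWeight, ENNReal.ofReal_mul (by positivity)]

/-- The factors `1/n` and `n^{-q/p}` merge into one weight. Passing to `ENNReal` lets sums,
integrals and expectations be exchanged freely. -/
theorem pqTypeSLLN_iff {Ω B : Type*} [MeasurableSpace Ω] [NormedAddCommGroup B]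
    (μ : Measure Ω) (Xs : ℕ → Ω → B) (p q : ℝ) :
    PQTypeSLLN μ Xs p q ↔ ∀ᵐ ω ∂μ, ∑' n : ℕ, slWeight (q / p) n *
      ENNReal.ofReal (‖partialSum Xs (n + 1) ω‖ ^ q) < ⊤ := by
  unfold PQTypeSLLN
  refine Filter.eventually_congr (Filter.Eventually.of_forall fun ω => ?_)
  have key : ∀ n : ℕ, 1 / ((n + 1 : ℕ) : ℝ) *
      (‖partialSum Xs (n + 1) ω‖ / ((n + 1 : ℕ) : ℝ) ^ (1 / p)) ^ q =
      ((n + 1 : ℕ) : ℝ) ^ (-(1 + q / p)) * ‖partialSum Xs (n + 1) ω‖ ^ q := by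
    intro n
    have hn : (0 : ℝ) < ((n + 1 : ℕ) : ℝ) := by positivity
    rw [Real.div_rpow (norm_nonneg _) (by positivity), ← Real.rpow_mul hn.le,
      Real.rpow_neg hn.le, Real.rpow_add hn, Real.rpow_one, one_div_mul_eq_div p q]
    field_simp
  simp_rw [key, slWeight_mul_ofReal]
  constructor
  · intro h
    rw [← ENNReal.ofReal_tsum_of_nonneg (fun n => by positivity) h]
    exact ENNReal.ofReal_lt_top
  · intro h
    have := ENNReal.summable_toReal h.ne
    refine this.congr fun n => ?_
    rw [ENNReal.toReal_ofReal (by positivity)]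

/-! ### Single big jump lower bound -/

/-- Bonferroni's inequality for intersections of equiprobable pairwise independent events with
events of large probability. -/
theorem card_mul_sub_le_measureReal_biUnion {Ω ι : Type*} [MeasurableSpace Ω] (μ : Measure Ω)
    [IsProbabilityMeasure μ] (U V : ι → Set Ω) (hU : ∀ k, MeasurableSet (U k))
    (hV : ∀ k, MeasurableSet (V k)) (π : ℝ) (J : Finset ι)
    (hπ : ∀ k ∈ J, μ.real (U k) = π)
    (hUU : ∀ i ∈ J, ∀ j ∈ J, i ≠ j → μ.real (U i ∩ U j) = π * π)
    (hUV : ∀ k ∈ J, μ.real (U k ∩ V k) = π * μ.real (V k))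
    (hV34 : ∀ k ∈ J, 3 / 4 ≤ μ.real (V k)) :
    J.card * (3 / 4 * π) - (J.card * π) ^ 2 / 2 ≤ μ.real (⋃ k ∈ J, U k ∩ V k) := by
  classical
  induction J using Finset.induction_on with
  | empty => simp
  | insert a s ha ih =>
    have ih' := ih (fun k hk => hπ k (Finset.mem_insert_of_mem hk))
      (fun i hi j hj => hUU i (Finset.mem_insert_of_mem hi) j (Finset.mem_insert_of_mem hj))
      (fun k hk => hUV k (Finset.mem_insert_of_mem hk))
      (fun k hk => hV34 k (Finset.mem_insert_of_mem hk))
    have ham := Finset.mem_insert_self a s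
    have hπ0 : 0 ≤ π := by rw [← hπ a ham]; exact measureReal_nonneg
    rw [Finset.set_biUnion_insert, Finset.card_insert_of_notMem ha]
    have hmeas : MeasurableSet (⋃ k ∈ s, U k ∩ V k) :=
      Finset.measurableSet_biUnion _ fun k _ => (hU k).inter (hV k)
    have h1 := measureReal_union_add_inter (μ := μ) (s := U a ∩ V a) hmeas
      (measure_ne_top _ _) (measure_ne_top _ _)
    have h2 : μ.real ((U a ∩ V a) ∩ ⋃ k ∈ s, U k ∩ V k) ≤ s.card * (π * π) := by
      calc _ ≤ μ.real (⋃ k ∈ s, U a ∩ U k) := by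
            refine measureReal_mono ?_ (measure_ne_top _ _)
            rintro ω ⟨⟨h, _⟩, h'⟩
            simp only [Set.mem_iUnion] at h' ⊢
            obtain ⟨k, hk, hk'⟩ := h'
            exact ⟨k, hk, h, hk'.1⟩
        _ ≤ ∑ k ∈ s, μ.real (U a ∩ U k) := measureReal_biUnion_finset_le _ _
        _ = ∑ k ∈ s, π * π := by
            refine Finset.sum_congr rfl fun k hk => ?_
            exact hUU a ham k (Finset.mem_insert_of_mem hk) (fun h => ha (h ▸ hk))
        _ = _ := by simp
    have h3 := hUV a ham
    have h4 := mul_le_mul_of_nonneg_left (hV34 a ham) hπ0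
    push_cast
    nlinarith [sq_nonneg π]

/-- The quadratic term in Bonferroni's bound is harmless only while the expected number of events is
small, so an overly large family is thinned first. -/
theorem min_one_card_mul_le_measureReal_biUnion {Ω ι : Type*} [MeasurableSpace Ω] (μ : Measure Ω)
    [IsProbabilityMeasure μ] (U V : ι → Set Ω) (hU : ∀ k, MeasurableSet (U k))
    (hV : ∀ k, MeasurableSet (V k)) (π : ℝ) (J : Finset ι) (hπ8 : π ≤ 1 / 8)
    (hπ : ∀ k ∈ J, μ.real (U k) = π)
    (hUU : ∀ i ∈ J, ∀ j ∈ J, i ≠ j → μ.real (U i ∩ U j) = π * π)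
    (hUV : ∀ k ∈ J, μ.real (U k ∩ V k) = π * μ.real (V k))
    (hV34 : ∀ k ∈ J, 3 / 4 ≤ μ.real (V k)) :
    1 / 8 * min 1 (J.card * π) ≤ μ.real (⋃ k ∈ J, U k ∩ V k) := by
  rcases J.eq_empty_or_nonempty with rfl | ⟨a, ha⟩
  · simp
  have hπ0 : 0 ≤ π := by rw [← hπ a ha]; exact measureReal_nonneg
  -- With `x = |J'| π ≤ 3/8`, Bonferroni gives `x (3/4 - x/2) ≥ 9x/16`, and `min(1, |J| π) ≤ 4x`.
  -- Thinning to `⌈1/(4π)⌉` indices overshoots `1/4` by at most `π ≤ 1/8`.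
  obtain ⟨J', hJ', h1, h2⟩ : ∃ J' ⊆ J, (J'.card : ℝ) * π ≤ 3 / 8 ∧
      min (1 / 4) (J.card * π) ≤ J'.card * π := by
    by_cases h : J.card * π ≤ 3 / 8
    · exact ⟨J, subset_rfl, h, min_le_right _ _⟩
    · push Not at h
      have hpos : 0 < π := by
        rcases hπ0.eq_or_lt with h0 | h0
        · rw [← h0] at h; norm_num at h
        · exact h0
      have hm1 := Nat.le_ceil (1 / (4 * π))
      have hm2 := Nat.ceil_lt_add_one (show 0 ≤ 1 / (4 * π) by positivity)
      have e : 1 / (4 * π) * π = 1 / 4 := by field_simp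
      have hm1' := mul_le_mul_of_nonneg_right hm1 hπ0
      have hm2' := mul_lt_mul_of_pos_right hm2 hpos
      have hmJ : ⌈1 / (4 * π)⌉₊ ≤ J.card := by
        have : (⌈1 / (4 * π)⌉₊ : ℝ) * π ≤ J.card * π := by nlinarith
        exact_mod_cast le_of_mul_le_mul_right this hpos
      obtain ⟨t, ht, htc⟩ := Finset.exists_subset_card_eq hmJ
      refine ⟨t, ht, ?_, ?_⟩
      · rw [htc]; nlinarith
      · rw [htc]; exact (min_le_left _ _).trans (by nlinarith)
  have h3 := card_mul_sub_le_measureReal_biUnion μ U V hU hV π J' (fun k hk => hπ k (hJ' hk))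
    (fun i hi j hj => hUU i (hJ' hi) j (hJ' hj)) (fun k hk => hUV k (hJ' hk))
    (fun k hk => hV34 k (hJ' hk))
  have h4 : μ.real (⋃ k ∈ J', U k ∩ V k) ≤ μ.real (⋃ k ∈ J, U k ∩ V k) :=
    measureReal_mono (Set.biUnion_subset_biUnion_left hJ') (measure_ne_top _ _)
  refine le_trans ?_ (h3.trans h4)
  have hx0 : 0 ≤ (J'.card : ℝ) * π := by positivity
  have h5 : min 1 (J.card * π) ≤ 4 * ((J'.card : ℝ) * π) := by
    rcases min_le_iff.1 h2 with h | h
    · exact (min_le_left _ _).trans (by linarith)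
    · exact (min_le_right _ _).trans (by linarith)
  nlinarith

/-- Mutual independence is needed here: the `k`-th variable must be independent of events generated
jointly by all the other variables, infinitely many in the case of the erased series. -/
theorem measureReal_inter_of_measurable_compl {Ω B : Type*} [mΩ : MeasurableSpace Ω]
    (μ : Measure Ω) [IsProbabilityMeasure μ] [mB : MeasurableSpace B] (Xs : ℕ → Ω → B)
    (hXs : ∀ n, Measurable (Xs n)) (hindep : iIndepFun Xs μ) (k : ℕ) (D : Set B)
    (hD : MeasurableSet D) (V : Set Ω)
    (hV : MeasurableSet[⨆ i ∈ ({k}ᶜ : Set ℕ), mB.comap (Xs i)] V) :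
    μ.real (Xs k ⁻¹' D ∩ V) = μ.real (Xs k ⁻¹' D) * μ.real V := by
  have h := indep_iSup_of_disjoint (μ := μ) (m := fun i => mB.comap (Xs i))
    (fun i => (hXs i).comap_le) ((iIndepFun_iff_iIndep _ _ _).1 hindep)
    (S := {k}) (T := {k}ᶜ) disjoint_compl_right
  rw [Indep_iff] at h
  have := h (Xs k ⁻¹' D) V ((le_iSup₂ (f := fun i (_ : i ∈ ({k} : Set ℕ)) => mB.comap (Xs i)) k rfl) _
    ⟨D, hD, rfl⟩) hV
  simp only [measureReal_def, this, ENNReal.toReal_mul]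

theorem iSup_comap_le {Ω B : Type*} [mΩ : MeasurableSpace Ω] [mB : MeasurableSpace B]
    (Xs : ℕ → Ω → B) (hXs : ∀ n, Measurable (Xs n)) (T : Set ℕ) :
    (⨆ i ∈ T, mB.comap (Xs i)) ≤ mΩ :=
  iSup₂_le fun i _ => (hXs i).comap_le

theorem measurable_sum_erase {Ω B : Type*} [NormedAddCommGroup B]
    [SecondCountableTopology B] [mB : MeasurableSpace B] [BorelSpace B]
    (Xs : ℕ → Ω → B) (k : ℕ) (s : Finset ℕ) :
    Measurable[⨆ i ∈ ({k}ᶜ : Set ℕ), mB.comap (Xs i)]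
      (fun ω => ∑ i ∈ s.erase k, Xs i ω) := by
  refine Finset.measurable_fun_sum _ fun i hi => ?_
  have h1 : mB.comap (Xs i) ≤ ⨆ i ∈ ({k}ᶜ : Set ℕ), mB.comap (Xs i) :=
    le_iSup₂ (f := fun i (_ : i ∈ ({k}ᶜ : Set ℕ)) => mB.comap (Xs i)) i
      (by simpa using Finset.ne_of_mem_erase hi)
  exact Measurable.of_comap_le h1

/-- A large jump of one summand makes the partial sum large, with a probability comparable to the
expected number of large jumps; the events `A`, `A' k`, `A''` record an additional restriction. -/
theorem min_one_card_mul_le_measureReal_norm_partialSum_gt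
    {Ω : Type*} [MeasurableSpace Ω] (μ : Measure Ω) [IsProbabilityMeasure μ]
    {B : Type*} [NormedAddCommGroup B]
    [SecondCountableTopology B] [mB : MeasurableSpace B] [BorelSpace B]
    {q : ℝ} (hq : 0 ≤ q) (hq1 : q ≤ 1)
    {X : Ω → B} {Xs : ℕ → Ω → B} (hXs : ∀ n, Measurable (Xs n))
    (hindep : iIndepFun Xs μ) (hident : ∀ n, IdentDistrib (Xs n) X μ μ)
    {C s : ℝ} (hC : μ.real {ω | C < ‖X ω‖ ^ q} ≤ 1 / 16) (hs : C ≤ s) (hs0 : 0 ≤ s)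
    {n : ℕ} {J : Finset ℕ} (hJ : J ⊆ Finset.range n)
    {D : Set B} (hD : MeasurableSet D) (hDs : ∀ x ∈ D, 3 * s < ‖x‖ ^ q)
    {A A'' : Set Ω} {A' : ℕ → Set Ω} (hAle : μ.real Aᶜ ≤ 1 / 16)
    (hA' : ∀ k, MeasurableSet[⨆ i ∈ ({k}ᶜ : Set ℕ), mB.comap (Xs i)] (A' k))
    (hAA' : ∀ k ∈ J, ∀ ω ∈ A, ‖Xs k ω‖ ^ q ≤ C → ω ∈ A' k)
    (hA'A'' : ∀ k ∈ J, ∀ ω ∈ A' k, Xs k ω ∈ D → ω ∈ A'') (hAA'' : A ⊆ A'') :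
    1 / 16 * min 1 (J.card * μ.real (X ⁻¹' D)) ≤
      μ.real ({ω | s < ‖partialSum Xs n ω‖ ^ q} ∩ A'') := by
  have hπ : ∀ k, μ.real (Xs k ⁻¹' D) = μ.real (X ⁻¹' D) := fun k => by
    rw [measureReal_def, measureReal_def, (hident k).measure_mem_eq hD]
  have hmq : Measurable fun x : B => ‖x‖ ^ q := by fun_prop
  have hCk : ∀ k, μ.real {ω | C < ‖Xs k ω‖ ^ q} ≤ 1 / 16 := fun k => by
    refine le_trans (le_of_eq ?_) hC
    have := (hident k).measure_mem_eq (s := {x : B | C < ‖x‖ ^ q})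
      (measurableSet_lt measurable_const hmq)
    rw [measureReal_def, measureReal_def]
    exact congrArg _ this
  have hSm : Measurable (partialSum Xs n) :=
    Finset.measurable_fun_sum _ fun i _ => hXs i
  have hG0 : MeasurableSet {ω | s < ‖partialSum Xs n ω‖ ^ q} :=
    measurableSet_lt measurable_const (hmq.comp hSm)
  -- If the sum is already large with probability `1/8`, discarding the complement of `A` leaves
  -- `1/16`. Otherwise the sum is usually small, and so is the sum without its `k`-th term; a jump
  -- of size above `3s` then pushes the whole sum above `s`.
  by_cases hcase : 1 / 8 ≤ μ.real {ω | s < ‖partialSum Xs n ω‖ ^ q}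
  · have h1 : μ.real {ω | s < ‖partialSum Xs n ω‖ ^ q} ≤
        μ.real ({ω | s < ‖partialSum Xs n ω‖ ^ q} ∩ A'') + μ.real Aᶜ := by
      refine (measureReal_mono ?_ (measure_ne_top _ _)).trans (measureReal_union_le _ _)
      intro ω hω
      by_cases h : ω ∈ A
      · exact Or.inl ⟨hω, hAA'' h⟩
      · exact Or.inr h
    have h2 := min_le_left (1 : ℝ) (J.card * μ.real (X ⁻¹' D))
    linarith
  push Not at hcase
  set V : ℕ → Set Ω := fun k => {ω | ‖∑ i ∈ (Finset.range n).erase k, Xs i ω‖ ^ q ≤ 2 * s} ∩ A' k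
    with hVdef
  have hVm : ∀ k, MeasurableSet[⨆ i ∈ ({k}ᶜ : Set ℕ), mB.comap (Xs i)] (V k) := by
    intro k
    refine MeasurableSet.inter ?_ (hA' k)
    exact (hmq.comp (measurable_sum_erase Xs k _)) measurableSet_Iic
  have herase : ∀ k ∈ J, ∀ ω, ∑ i ∈ (Finset.range n).erase k, Xs i ω + Xs k ω
      = partialSum Xs n ω := fun k hk ω => Finset.sum_erase_add _ _ (hJ hk)
  have hbon := min_one_card_mul_le_measureReal_biUnion μ (fun k => Xs k ⁻¹' D) V
    (fun k => hXs k hD) (fun k => iSup_comap_le Xs hXs _ _ (hVm k)) (μ.real (X ⁻¹' D)) J ?_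
    (fun k _ => hπ k) ?_ ?_ ?_
  · have hsub : (⋃ k ∈ J, Xs k ⁻¹' D ∩ V k) ⊆ {ω | s < ‖partialSum Xs n ω‖ ^ q} ∩ A'' := by
      intro ω hω
      simp only [Set.mem_iUnion] at hω
      obtain ⟨k, hk, h1, h2, h3⟩ := hω
      refine ⟨?_, hA'A'' k hk ω h3 h1⟩
      have e : Xs k ω = partialSum Xs n ω - ∑ i ∈ (Finset.range n).erase k, Xs i ω := by
        rw [← herase k hk ω]; abel
      have h4 := norm_sub_rpow_le hq hq1 (partialSum Xs n ω)
        (∑ i ∈ (Finset.range n).erase k, Xs i ω)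
      rw [← e] at h4
      have h5 := hDs _ h1
      simp only [Set.mem_ofPred_eq] at h2 ⊢
      linarith
    have := measureReal_mono hsub (measure_ne_top μ _)
    have h0 : 0 ≤ min 1 (J.card * μ.real (X ⁻¹' D)) :=
      le_min zero_le_one (mul_nonneg (Nat.cast_nonneg _) measureReal_nonneg)
    linarith
  · have : μ.real (X ⁻¹' D) ≤ μ.real {ω | C < ‖X ω‖ ^ q} := by
      refine measureReal_mono (fun ω hω => ?_) (measure_ne_top _ _)
      have := hDs _ hω
      simp only [Set.mem_ofPred_eq]
      linarith
    linarith
  · intro i _ j _ hij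
    have := (hindep.indepFun hij).measure_inter_preimage_eq_mul D D hD hD
    rw [measureReal_def, this, ENNReal.toReal_mul, ← measureReal_def, ← measureReal_def, hπ, hπ]
  · intro k _
    rw [measureReal_inter_of_measurable_compl μ Xs hXs hindep k D hD _ (hVm k), hπ]
  · intro k hk
    -- Off these three events the erased sum has `q`-th power at most `s + C ≤ 2s`. Their
    -- probabilities add up to at most `1/8 + 1/16 + 1/16 = 1/4`.
    have h1 : μ.real (V k)ᶜ ≤ μ.real {ω | s < ‖partialSum Xs n ω‖ ^ q} +
        μ.real {ω | C < ‖Xs k ω‖ ^ q} + μ.real Aᶜ := by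
      refine (measureReal_mono ?_ (measure_ne_top _ _)).trans
        ((measureReal_union_le _ _).trans (add_le_add_left (measureReal_union_le _ _) _))
      intro ω hω
      by_contra hcon
      simp only [Set.mem_union, Set.mem_ofPred_eq, Set.mem_compl_iff, not_or, not_lt,
        not_not] at hcon
      obtain ⟨⟨h1, h2⟩, h3⟩ := hcon
      refine hω ⟨?_, hAA' k hk ω h3 h2⟩
      have e : ∑ i ∈ (Finset.range n).erase k, Xs i ω = partialSum Xs n ω - Xs k ω := by
        rw [← herase k hk ω]; abel
      have h4 := norm_sub_rpow_le hq hq1 (partialSum Xs n ω) (Xs k ω)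
      rw [← e] at h4
      simp only [Set.mem_ofPred_eq]
      linarith
    have h2 := probReal_compl_eq_one_sub (μ := μ) (iSup_comap_le Xs hXs _ _ (hVm k))
    have := hCk k
    linarith

/-! ### Events of boundedness and the layer-cake bound -/

theorem exists_measureReal_gt_le {Ω : Type*} [MeasurableSpace Ω] (μ : Measure Ω)
    [IsProbabilityMeasure μ] {f : Ω → ENNReal} (hf : Measurable f) (hfin : ∀ᵐ ω ∂μ, f ω < ⊤)
    {ε : ℝ} (hε : 0 < ε) : ∃ M : ℕ, μ.real {ω | f ω ≤ M}ᶜ ≤ ε := by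
  have h : Filter.Tendsto (fun M : ℕ => μ {ω | f ω ≤ M}ᶜ) Filter.atTop
      (nhds (μ (⋂ M : ℕ, {ω | f ω ≤ M}ᶜ))) := by
    refine tendsto_measure_iInter_atTop
      (fun M => (measurableSet_le hf measurable_const).compl.nullMeasurableSet) ?_
      ⟨0, measure_ne_top _ _⟩
    intro a b hab ω hω
    simp only [Set.mem_compl_iff, Set.mem_ofPred_eq, not_le] at hω ⊢
    exact lt_of_le_of_lt (by exact_mod_cast hab) hω
  have h0 : μ (⋂ M : ℕ, {ω | f ω ≤ M}ᶜ) = 0 := by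
    refine measure_mono_null ?_ hfin
    intro ω hω
    simp only [Set.mem_iInter, Set.mem_compl_iff, Set.mem_ofPred_eq, not_le] at hω ⊢
    intro hlt
    obtain ⟨M, hM⟩ := ENNReal.exists_nat_gt hlt.ne
    exact absurd (hω M) (not_lt.2 hM.le)
  rw [h0] at h
  obtain ⟨M, hM⟩ := ((ENNReal.tendsto_nhds_zero.1 h) (ENNReal.ofReal ε)
    (ENNReal.ofReal_pos.2 hε)).exists
  exact ⟨M, ENNReal.toReal_le_of_le_ofReal hε.le hM⟩

theorem exists_measureReal_real_gt_le {Ω : Type*} [MeasurableSpace Ω] (μ : Measure Ω)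
    [IsProbabilityMeasure μ] {f : Ω → ℝ} (hf : Measurable f)
    {ε : ℝ} (hε : 0 < ε) : ∃ M : ℝ, 0 ≤ M ∧ μ.real {ω | M < f ω} ≤ ε := by
  obtain ⟨M, hM⟩ := exists_measureReal_gt_le μ (f := fun ω => ENNReal.ofReal (f ω))
    (by fun_prop) (by simp) hε
  refine ⟨M, M.cast_nonneg, le_trans (measureReal_mono ?_ (measure_ne_top _ _)) hM⟩
  intro ω hω h
  simp only [Set.mem_ofPred_eq] at hω h
  rw [← ENNReal.ofReal_natCast, ENNReal.ofReal_le_ofReal_iff M.cast_nonneg] at h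
  linarith

theorem measurable_measure_lt_inter {Ω : Type*} [MeasurableSpace Ω] (μ : Measure Ω)
    (f : Ω → ℝ) (A : Set Ω) : Measurable fun t : ℝ => μ ({ω | t < f ω} ∩ A) := by
  refine Antitone.measurable fun a b hab => measure_mono ?_
  exact Set.inter_subset_inter_left _ fun ω hω => lt_of_le_of_lt hab hω

/-- Layer-cake bound for a weighted series on an event on which it is bounded. -/
theorem lintegral_tsum_mul_meas_le {Ω : Type*} [MeasurableSpace Ω] (μ : Measure Ω)
    [IsProbabilityMeasure μ] {c : ℕ → ENNReal} {f : ℕ → Ω → ℝ} (hf : ∀ n, Measurable (f n))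
    (hf0 : ∀ n ω, 0 ≤ f n ω) {M : ENNReal} {A : Set Ω} (hA : MeasurableSet A)
    (hAM : ∀ ω ∈ A, ∑' n, c n * ENNReal.ofReal (f n ω) ≤ M) :
    ∫⁻ t in Set.Ioi (0 : ℝ), ∑' n, c n * μ ({ω | t < f n ω} ∩ A) ≤ M := by
  calc ∫⁻ t in Set.Ioi (0 : ℝ), ∑' n, c n * μ ({ω | t < f n ω} ∩ A)
      = ∑' n, c n * ∫⁻ t in Set.Ioi (0 : ℝ), μ ({ω | t < f n ω} ∩ A) := by
        rw [lintegral_tsum fun n =>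
          ((measurable_measure_lt_inter μ (f n) A).const_mul _).aemeasurable]
        exact tsum_congr fun n => lintegral_const_mul _ (measurable_measure_lt_inter μ (f n) A)
    _ = ∑' n, ∫⁻ ω in A, c n * ENNReal.ofReal (f n ω) ∂μ := by
        refine tsum_congr fun n => ?_
        rw [lintegral_const_mul _ (by fun_prop),
          lintegral_eq_lintegral_meas_lt _ (Filter.Eventually.of_forall (hf0 n))
            (hf n).aemeasurable]
        congr 1
        refine lintegral_congr fun t => ?_
        rw [Measure.restrict_apply (measurableSet_lt measurable_const (hf n))]
    _ = ∫⁻ ω in A, ∑' n, c n * ENNReal.ofReal (f n ω) ∂μ :=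
        (lintegral_tsum fun n => by fun_prop).symm
    _ ≤ ∫⁻ ω in A, M ∂μ := setLIntegral_mono' hA hAM
    _ ≤ M := by
        rw [setLIntegral_const]
        exact mul_le_of_le_one_right' prob_le_one

/-! ### Necessity of the tail integral -/

/-- With `m = ⌈1/π⌉ ≤ 2/π`, the `m` integers of `[m, 2m)` all qualify and each has weight at least
`(2m)^{-(1+α)}`. -/
theorem ofReal_rpow_le_tsum_slWeight {α π : ℝ} (hα : 0 < α) (hπ : 0 < π) (hπ1 : π ≤ 1) :
    ENNReal.ofReal (2 ^ (-(1 + 2 * α)) * π ^ α) ≤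
      ∑' n : ℕ, if 1 ≤ ((n + 1 : ℕ) : ℝ) * π then slWeight α n else 0 := by
  set m := ⌈1 / π⌉₊ with hm
  have hm1 : 1 / π ≤ m := Nat.le_ceil _
  have hm2 : (m : ℝ) ≤ 2 / π := by
    have h1 := Nat.ceil_lt_add_one (show 0 ≤ 1 / π by positivity)
    have h2 : 1 ≤ 1 / π := by rw [le_div_iff₀ hπ]; linarith
    have h3 : (2 : ℝ) / π = 1 / π + 1 / π := by ring
    rw [h3]; linarith
  have hmpos : (0 : ℝ) < m := lt_of_lt_of_le (by positivity) hm1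
  have hterm : ∀ n ∈ Finset.Ico (m - 1) (2 * m - 1),
      ENNReal.ofReal ((2 * m : ℝ) ^ (-(1 + α))) ≤
        if 1 ≤ ((n + 1 : ℕ) : ℝ) * π then slWeight α n else 0 := by
    intro n hn
    rw [Finset.mem_Ico] at hn
    have hmn : m ≤ n + 1 := by omega
    have hn2 : n + 1 ≤ 2 * m := by omega
    have h1 : 1 ≤ ((n + 1 : ℕ) : ℝ) * π := by
      have : 1 / π ≤ ((n + 1 : ℕ) : ℝ) := hm1.trans (by exact_mod_cast hmn)
      rwa [div_le_iff₀ hπ] at this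
    rw [if_pos h1, slWeight]
    refine ENNReal.ofReal_le_ofReal ?_
    refine Real.rpow_le_rpow_of_nonpos (by positivity) (by exact_mod_cast hn2) (by linarith)
  have hmn : 1 ≤ m := by exact_mod_cast hmpos
  calc ENNReal.ofReal (2 ^ (-(1 + 2 * α)) * π ^ α)
      ≤ ENNReal.ofReal (m * (2 * m : ℝ) ^ (-(1 + α))) := by
        refine ENNReal.ofReal_le_ofReal ?_
        have e1 : (m : ℝ) * (2 * m : ℝ) ^ (-(1 + α)) = 2 ^ (-(1 + α)) * (m : ℝ) ^ (-α) := by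
          rw [Real.mul_rpow (by norm_num) hmpos.le, mul_left_comm]
          congr 1
          conv_lhs => rw [← Real.rpow_one (m : ℝ), ← Real.rpow_mul hmpos.le,
            ← Real.rpow_add hmpos]
          congr 1; ring
        have e2 : (2 : ℝ) ^ (-(1 + 2 * α)) * π ^ α = 2 ^ (-(1 + α)) * (2 / π) ^ (-α) := by
          rw [Real.div_rpow (by norm_num) hπ.le, Real.rpow_neg hπ.le, div_inv_eq_mul, ← mul_assoc,
            ← Real.rpow_add (by norm_num)]
          congr 2; ring
        rw [e1, e2]
        gcongr 2 ^ (-(1 + α)) * ?_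
        exact Real.rpow_le_rpow_of_nonpos hmpos hm2 (by linarith)
    _ = ∑ n ∈ Finset.Ico (m - 1) (2 * m - 1), ENNReal.ofReal ((2 * m : ℝ) ^ (-(1 + α))) := by
        rw [Finset.sum_const, Nat.card_Ico, nsmul_eq_mul, ENNReal.ofReal_mul hmpos.le,
          ENNReal.ofReal_natCast]
        congr 3; omega
    _ ≤ _ := (Finset.sum_le_sum hterm).trans (ENNReal.sum_le_tsum _)

theorem lintegral_Ioi_lt_top_of_le {g : ℝ → ENNReal} (hg : ∀ t, g t ≤ 1) {K : ℝ} (hK : 0 ≤ K)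
    (h : ∫⁻ t in Set.Ioi K, g t < ⊤) : ∫⁻ t in Set.Ioi (0 : ℝ), g t < ⊤ := by
  rw [← Set.Ioc_union_Ioi_eq_Ioi hK]
  refine (lintegral_union_le _ _ _).trans_lt (ENNReal.add_lt_top.2 ⟨?_, h⟩)
  calc ∫⁻ t in Set.Ioc 0 K, g t ≤ ∫⁻ t in Set.Ioc 0 K, 1 := lintegral_mono fun t => hg t
    _ < ⊤ := by simp

theorem lintegral_rpow_lt_top_of_pqTypeSLLN
    {Ω : Type*} [MeasurableSpace Ω] (μ : Measure Ω) [IsProbabilityMeasure μ]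
    {B : Type*} [NormedAddCommGroup B]
    [SecondCountableTopology B] [MeasurableSpace B] [BorelSpace B]
    {p q : ℝ} (hq : 0 < q) (hq1 : q ≤ 1) (hp : 0 < p)
    {X : Ω → B} {Xs : ℕ → Ω → B}
    (hX : Measurable X) (hXs : ∀ n, Measurable (Xs n))
    (hindep : iIndepFun Xs μ) (hident : ∀ n, IdentDistrib (Xs n) X μ μ)
    (h : PQTypeSLLN μ Xs p q) :
    ∫⁻ t in Set.Ioi (0 : ℝ), (μ {ω | t < ‖X ω‖ ^ q}) ^ (q / p) < ⊤ := by
  rw [pqTypeSLLN_iff] at h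
  have hα : 0 < q / p := by positivity
  have hSm : ∀ n, Measurable fun ω => ‖partialSum Xs n ω‖ ^ q := fun n =>
    (Measurable.norm (Finset.measurable_fun_sum _ fun i _ => hXs i)).pow_const q
  have hFm : Measurable fun ω => ∑' n : ℕ, slWeight (q / p) n *
      ENNReal.ofReal (‖partialSum Xs (n + 1) ω‖ ^ q) :=
    Measurable.tsum fun n => ((hSm (n + 1)).ennreal_ofReal).const_mul _
  -- The jump bound will give `1/16` when `n π ≥ 1`; losing `1/32` to the complement of `A` still
  -- leaves `1/32`, the constant in `κ`.
  obtain ⟨M, hM⟩ := exists_measureReal_gt_le μ hFm h (ε := 1 / 32) (by norm_num)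
  obtain ⟨C, hC0, hC⟩ := exists_measureReal_real_gt_le μ
    (f := fun ω => ‖X ω‖ ^ q) (by fun_prop) (ε := 1 / 16) (by norm_num)
  set A := {ω | ∑' n : ℕ, slWeight (q / p) n *
    ENNReal.ofReal (‖partialSum Xs (n + 1) ω‖ ^ q) ≤ M} with hAdef
  have hA : MeasurableSet A := measurableSet_le hFm measurable_const
  have hint := lintegral_tsum_mul_meas_le μ (c := slWeight (q / p))
    (f := fun n ω => 3 * ‖partialSum Xs (n + 1) ω‖ ^ q) (M := 3 * M) (A := A)
    (fun n => (hSm (n + 1)).const_mul 3) (fun n ω => by positivity) hA (by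
      intro ω hω
      have e : ∀ n : ℕ, slWeight (q / p) n * ENNReal.ofReal (3 * ‖partialSum Xs (n + 1) ω‖ ^ q) =
          3 * (slWeight (q / p) n * ENNReal.ofReal (‖partialSum Xs (n + 1) ω‖ ^ q)) := by
        intro n
        rw [ENNReal.ofReal_mul (by norm_num)]
        simp only [ENNReal.ofReal_ofNat]
        ring
      simp_rw [e, ENNReal.tsum_mul_left]
      gcongr
      exact hω)
  set κ : ENNReal := ENNReal.ofReal (1 / 32 * 2 ^ (-(1 + 2 * (q / p)))) with hκ
  have hκ0 : κ ≠ 0 := by rw [hκ]; simp; positivity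
  have hlow : ∀ t ∈ Set.Ioi (3 * C), κ * (μ {ω | t < ‖X ω‖ ^ q}) ^ (q / p) ≤
      ∑' n : ℕ, slWeight (q / p) n * μ ({ω | t < 3 * ‖partialSum Xs (n + 1) ω‖ ^ q} ∩ A) := by
    intro t ht
    have ht' : 3 * C < t := ht
    set π := μ.real {ω | t < ‖X ω‖ ^ q} with hπdef
    have hμπ : μ {ω | t < ‖X ω‖ ^ q} = ENNReal.ofReal π := (ofReal_measureReal).symm
    rcases (measureReal_nonneg (μ := μ) (s := {ω | t < ‖X ω‖ ^ q})).eq_or_lt with h0 | h0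
    · rw [hμπ, hπdef, ← h0]; simp [hα]
    have h1 := ofReal_rpow_le_tsum_slWeight hα h0 measureReal_le_one
    rw [hμπ, ENNReal.ofReal_rpow_of_nonneg h0.le hα.le, hκ, ← ENNReal.ofReal_mul (by positivity),
      mul_assoc, ENNReal.ofReal_mul (by norm_num)]
    refine (mul_le_mul_right h1 _).trans ?_
    rw [← ENNReal.tsum_mul_left]
    refine ENNReal.tsum_le_tsum fun n => ?_
    split_ifs with hn
    · rw [mul_comm]
      gcongr
      have hD : MeasurableSet {x : B | t < ‖x‖ ^ q} :=
        measurableSet_lt measurable_const (by fun_prop)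
      have h2 := min_one_card_mul_le_measureReal_norm_partialSum_gt μ hq.le hq1 hXs hindep hident
        hC (s := t / 3) (by linarith) (by linarith) (n := n + 1) (J := Finset.range (n + 1))
        subset_rfl hD (fun x hx => by
          simp only [Set.mem_ofPred_eq] at hx
          linarith) (A := Set.univ) (A'' := Set.univ)
        (A' := fun _ => Set.univ) (by simp) (fun k => MeasurableSet.univ) (by simp) (by simp)
        (by simp)
      have e : X ⁻¹' {x : B | t < ‖x‖ ^ q} = {ω | t < ‖X ω‖ ^ q} := rfl
      rw [Finset.card_range, e, min_eq_left hn, Set.inter_univ] at h2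
      have h3 : μ.real {ω | t / 3 < ‖partialSum Xs (n + 1) ω‖ ^ q} ≤
          μ.real ({ω | t < 3 * ‖partialSum Xs (n + 1) ω‖ ^ q} ∩ A) + μ.real Aᶜ := by
        refine (measureReal_mono ?_ (measure_ne_top _ _)).trans (measureReal_union_le _ _)
        intro ω hω
        simp only [Set.mem_ofPred_eq] at hω
        by_cases h : ω ∈ A
        · exact Or.inl ⟨by simp only [Set.mem_ofPred_eq]; linarith, h⟩
        · exact Or.inr h
      rw [← ofReal_measureReal (μ := μ)
        (s := {ω | t < 3 * ‖partialSum Xs (n + 1) ω‖ ^ q} ∩ A)]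
      refine ENNReal.ofReal_le_ofReal ?_
      linarith
    · simp
  have hfin : ∫⁻ t in Set.Ioi (3 * C), (μ {ω | t < ‖X ω‖ ^ q}) ^ (q / p) < ⊤ := by
    have hmeas : Measurable fun t : ℝ => (μ {ω | t < ‖X ω‖ ^ q}) ^ (q / p) := by
      simpa using (measurable_measure_lt_inter μ (fun ω => ‖X ω‖ ^ q) Set.univ).pow_const (q / p)
    have h4 : κ * ∫⁻ t in Set.Ioi (3 * C), (μ {ω | t < ‖X ω‖ ^ q}) ^ (q / p) ≤ 3 * M := by
      rw [← lintegral_const_mul _ hmeas]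
      refine (setLIntegral_mono' measurableSet_Ioi hlow).trans (le_trans ?_ hint)
      exact lintegral_mono_set (Set.Ioi_subset_Ioi (by linarith))
    by_contra hcon
    rw [not_lt, top_le_iff] at hcon
    rw [hcon, ENNReal.mul_top hκ0, top_le_iff] at h4
    exact ENNReal.mul_ne_top (by simp) (by simp) h4
  exact lintegral_Ioi_lt_top_of_le (fun t => ENNReal.rpow_le_one prob_le_one hα.le)
    (by linarith) hfin

/-! ### Necessity for `q = p`: jumps that keep the series bounded -/

theorem tsum_slWeight_one_tail_le (k : ℕ) :
    ∑' j : ℕ, (if k ≤ j then slWeight 1 j else 0) ≤ ENNReal.ofReal (2 / (k + 1)) := by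
  refine ENNReal.tsum_le_of_sum_range_le fun N => ?_
  calc ∑ j ∈ Finset.range N, (if k ≤ j then slWeight 1 j else 0)
      = ∑ j ∈ Finset.Ico k N, slWeight 1 j := by
        rw [← Finset.sum_filter]
        congr 1; ext j; simp; tauto
    _ = ENNReal.ofReal (∑ j ∈ Finset.Ico k N, (((j + 1 : ℕ) : ℝ) ^ 2)⁻¹) := by
        rw [ENNReal.ofReal_sum_of_nonneg fun _ _ => by positivity]
        refine Finset.sum_congr rfl fun j _ => ?_
        rw [slWeight, Real.rpow_neg (by positivity)]
        norm_num
    _ ≤ _ := by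
        refine ENNReal.ofReal_le_ofReal (le_trans (le_of_eq ?_)
          (sum_Ioo_inv_sq_le (α := ℝ) k (N + 1)))
        rw [Finset.sum_Ico_add' (fun i : ℕ => ((i : ℝ) ^ 2)⁻¹) k N 1]
        rfl

theorem tsum_slWeight_one_lt_top : ∑' j : ℕ, slWeight 1 j < ⊤ := by
  have := tsum_slWeight_one_tail_le 0
  simp only [Nat.zero_le, if_true] at this
  exact this.trans_lt ENNReal.ofReal_lt_top

/-- `min (1, n P(t < Z ≤ n))`. -/
noncomputable def cappedTail {Ω : Type*} [MeasurableSpace Ω] (μ : Measure Ω) (Z : Ω → ℝ) (n : ℕ)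
    (t : ℝ) : ENNReal :=
  min 1 ((n : ENNReal) * μ {ω | t < Z ω ∧ Z ω ≤ n})

theorem measurable_cappedTail {Ω : Type*} [MeasurableSpace Ω] (μ : Measure Ω) (Z : Ω → ℝ) (n : ℕ) :
    Measurable (cappedTail μ Z n) := by
  refine Antitone.measurable fun a b hab => ?_
  unfold cappedTail
  gcongr

/-- The weighted series of `p`-th powers of norms of the partial sums with one summand erased. -/
noncomputable def erasedSeries {Ω B : Type*} [NormedAddCommGroup B] (Xs : ℕ → Ω → B) (p : ℝ)
    (k : ℕ) (ω : Ω) : ENNReal :=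
  ∑' j : ℕ, slWeight 1 j * ENNReal.ofReal (‖∑ i ∈ (Finset.range (j + 1)).erase k, Xs i ω‖ ^ p)

/-- The `k`-th summand enters only the partial sums from index `k` on, whose weights total at most
`2/(k+1)`. Hence inserting or erasing it moves the series by at most `2 z/(k+1)`, where `z` is the
`p`-th power of its norm. -/
theorem tsum_slWeight_one_le_add {f g : ℕ → ℝ} {z : ℝ} (hg : ∀ j, 0 ≤ g j) (hz : 0 ≤ z) (k : ℕ)
    (h : ∀ j, f j ≤ g j + if k ≤ j then z else 0) {K : ℝ} (hK : z * (2 / (k + 1)) ≤ K) :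
    ∑' j : ℕ, slWeight 1 j * ENNReal.ofReal (f j) ≤
      ∑' j : ℕ, slWeight 1 j * ENNReal.ofReal (g j) + ENNReal.ofReal K := by
  calc ∑' j : ℕ, slWeight 1 j * ENNReal.ofReal (f j)
      ≤ ∑' j : ℕ, (slWeight 1 j * ENNReal.ofReal (g j) +
          ENNReal.ofReal z * (if k ≤ j then slWeight 1 j else 0)) := by
        refine ENNReal.tsum_le_tsum fun j => ?_
        have h1 := ENNReal.ofReal_le_ofReal (h j)
        rw [ENNReal.ofReal_add (hg j) (by split_ifs <;> simp [hz])] at h1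
        refine (mul_le_mul_right h1 _).trans ?_
        rw [mul_add]
        split_ifs
        · rw [mul_comm (ENNReal.ofReal z)]
        · simp
    _ ≤ _ := by
        rw [ENNReal.tsum_add, ENNReal.tsum_mul_left]
        gcongr
        refine (mul_le_mul_right (tsum_slWeight_one_tail_le k) _).trans ?_
        rw [← ENNReal.ofReal_mul hz]
        exact ENNReal.ofReal_le_ofReal hK

theorem norm_partialSum_rpow_le_erase {Ω B : Type*} [NormedAddCommGroup B] {p : ℝ} (hp : 0 ≤ p)
    (hp1 : p ≤ 1) (Xs : ℕ → Ω → B) (k j : ℕ) (ω : Ω) :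
    ‖partialSum Xs (j + 1) ω‖ ^ p ≤ ‖∑ i ∈ (Finset.range (j + 1)).erase k, Xs i ω‖ ^ p +
        (if k ≤ j then ‖Xs k ω‖ ^ p else 0) ∧
      ‖∑ i ∈ (Finset.range (j + 1)).erase k, Xs i ω‖ ^ p ≤ ‖partialSum Xs (j + 1) ω‖ ^ p +
        (if k ≤ j then ‖Xs k ω‖ ^ p else 0) := by
  split_ifs with h
  · have e := Finset.sum_erase_add (Finset.range (j + 1)) (fun i => Xs i ω)
      (a := k) (by simpa using Nat.lt_succ_of_le h)
    constructor
    · rw [partialSum, ← e]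
      exact norm_add_rpow_le hp hp1 _ _
    · rw [eq_sub_of_add_eq e]
      exact norm_sub_rpow_le hp hp1 _ _
  · have e : (Finset.range (j + 1)).erase k = Finset.range (j + 1) :=
      Finset.erase_eq_of_notMem (by simp; omega)
    simp [e, partialSum]

theorem measurable_erasedSeries {Ω B : Type*} [NormedAddCommGroup B]
    [SecondCountableTopology B] [mB : MeasurableSpace B] [BorelSpace B]
    (Xs : ℕ → Ω → B) (p : ℝ) (k : ℕ) :
    Measurable[⨆ i ∈ ({k}ᶜ : Set ℕ), mB.comap (Xs i)] (erasedSeries Xs p k) := by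
  have hmq : Measurable fun x : B => ‖x‖ ^ p := by fun_prop
  let : MeasurableSpace Ω := ⨆ i ∈ ({k}ᶜ : Set ℕ), mB.comap (Xs i)
  refine Measurable.tsum fun j => Measurable.const_mul (Measurable.ennreal_ofReal ?_) _
  exact hmq.comp (measurable_sum_erase Xs k _)

/-- Subtracting a fixed probability would destroy the bound where `n P(t < ‖X‖^p ≤ n)` is small. The
boundedness of the series is therefore carried through the jump argument: it is transferred to the
series without the `k`-th summand, which is independent of the jump, and back to the full series
after the jump. -/
theorem lintegral_tsum_cappedTail_lt_top
    {Ω : Type*} [MeasurableSpace Ω] (μ : Measure Ω) [IsProbabilityMeasure μ]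
    {B : Type*} [NormedAddCommGroup B]
    [SecondCountableTopology B] [mB : MeasurableSpace B] [BorelSpace B]
    {p : ℝ} (hp : 0 < p) (hp1 : p ≤ 1)
    {X : Ω → B} {Xs : ℕ → Ω → B}
    (hX : Measurable X) (hXs : ∀ n, Measurable (Xs n))
    (hindep : iIndepFun Xs μ) (hident : ∀ n, IdentDistrib (Xs n) X μ μ)
    (h : PQTypeSLLN μ Xs p p) :
    ∫⁻ t in Set.Ioi (0 : ℝ), ∑' m : ℕ, slWeight 1 m *
      cappedTail μ (fun ω => ‖X ω‖ ^ p) (m + 1) t < ⊤ := by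
  rw [pqTypeSLLN_iff, div_self hp.ne'] at h
  have hmq : Measurable fun x : B => ‖x‖ ^ p := by fun_prop
  have hSm : ∀ n, Measurable fun ω => ‖partialSum Xs n ω‖ ^ p := fun n =>
    (Measurable.norm (Finset.measurable_fun_sum _ fun i _ => hXs i)).pow_const p
  set F : Ω → ENNReal := fun ω => ∑' n : ℕ, slWeight 1 n *
      ENNReal.ofReal (‖partialSum Xs (n + 1) ω‖ ^ p) with hFdef
  have hFm : Measurable F :=
    Measurable.tsum fun n => ((hSm (n + 1)).ennreal_ofReal).const_mul _
  obtain ⟨M, hM⟩ := exists_measureReal_gt_le μ hFm h (ε := 1 / 16) (by norm_num)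
  obtain ⟨C, hC0, hC⟩ := exists_measureReal_real_gt_le μ
    (f := fun ω => ‖X ω‖ ^ p) (by fun_prop) (ε := 1 / 16) (by norm_num)
  -- Erasing a summand with `‖X_k‖^p ≤ C` costs at most `2C/(k+1) ≤ 2C`. Restoring a jump with
  -- `‖X_k‖^p ≤ m + 1 ≤ k` costs at most `2`.
  set M₁ : ENNReal := M + ENNReal.ofReal (2 * C) with hM₁
  set M₂ : ENNReal := M₁ + ENNReal.ofReal 2 with hM₂
  have hM₂top : M₂ ≠ ⊤ := 
    ENNReal.add_ne_top.2 ⟨ENNReal.add_ne_top.2 ⟨by simp, ENNReal.ofReal_ne_top⟩,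
      ENNReal.ofReal_ne_top⟩
  set A := {ω | F ω ≤ M₂} with hAdef
  have hA : MeasurableSet A := measurableSet_le hFm measurable_const
  have hint := lintegral_tsum_mul_meas_le μ (c := slWeight 1)
    (f := fun n ω => 3 * ‖partialSum Xs (n + 1) ω‖ ^ p) (M := 3 * M₂) (A := A)
    (fun n => (hSm (n + 1)).const_mul 3) (fun n ω => by positivity) hA (by
      intro ω hω
      have e : ∀ n : ℕ, slWeight 1 n * ENNReal.ofReal (3 * ‖partialSum Xs (n + 1) ω‖ ^ p) =
          3 * (slWeight 1 n * ENNReal.ofReal (‖partialSum Xs (n + 1) ω‖ ^ p)) := by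
        intro n
        rw [ENNReal.ofReal_mul (by norm_num)]
        simp only [ENNReal.ofReal_ofNat]
        ring
      simp_rw [e, ENNReal.tsum_mul_left]
      gcongr
      exact hω)
  set κ : ENNReal := ENNReal.ofReal (1 / 64) with hκ
  have hlow : ∀ t ∈ Set.Ioi (3 * C), κ * ∑' m : ℕ, slWeight 1 m *
        cappedTail μ (fun ω => ‖X ω‖ ^ p) (m + 1) t ≤
      ∑' n : ℕ, slWeight 1 n * μ ({ω | t < 3 * ‖partialSum Xs (n + 1) ω‖ ^ p} ∩ A) := by
    intro t ht
    have ht' : 3 * C < t := ht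
    rw [← ENNReal.tsum_mul_left]
    -- Only even partial sums are used: `S_{2(m+1)}` has `m + 1` indices in its second half, late
    -- enough to allow jumps with `p`-th power up to `m + 1`. The doubled index costs the factor
    -- `1/4` in the weight, so `κ = 1/4 · 1/16`.
    refine le_trans (ENNReal.tsum_le_tsum fun m => ?_)
      (ENNReal.tsum_comp_le_tsum_of_injective (f := fun m : ℕ => 2 * m + 1)
        (fun a b hab => by simpa using hab) _)
    have hw : slWeight 1 (2 * m + 1) = ENNReal.ofReal (1 / 4) * slWeight 1 m := by
      rw [slWeight, slWeight, ← ENNReal.ofReal_mul (by norm_num)]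
      congr 1
      have : ((2 * m + 1 + 1 : ℕ) : ℝ) = 2 * ((m + 1 : ℕ) : ℝ) := by push_cast; ring
      rw [this, Real.mul_rpow (by norm_num) (by positivity)]
      congr 1
      rw [Real.rpow_neg (by norm_num)]; norm_num
    have hD : MeasurableSet {x : B | t < ‖x‖ ^ p ∧ ‖x‖ ^ p ≤ (m + 1 : ℕ)} :=
      (measurableSet_lt measurable_const hmq).inter (measurableSet_le hmq measurable_const)
    have h2 := min_one_card_mul_le_measureReal_norm_partialSum_gt μ hp.le hp1 hXs hindep hident
      hC (s := t / 3) (by linarith) (by linarith) (n := 2 * m + 1 + 1)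
      (J := Finset.Ico (m + 1) (2 * m + 1 + 1))
      (fun i hi => by simp at hi ⊢; omega) hD (fun x hx => by
        have := hx.1
        linarith) (A := {ω | F ω ≤ M}) (A'' := A)
      (A' := fun k => {ω | erasedSeries Xs p k ω ≤ M₁}) hM
      (fun k => measurable_erasedSeries Xs p k measurableSet_Iic)
      (fun k _ ω hω hk => by
        have := tsum_slWeight_one_le_add (fun j => by positivity) (z := ‖Xs k ω‖ ^ p)
          (by positivity) k (fun j => (norm_partialSum_rpow_le_erase hp.le hp1 Xs k j ω).2)
          (K := 2 * C) (by
            have h1 : (2 : ℝ) / (k + 1) ≤ 2 := by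
              rw [div_le_iff₀ (by positivity)]; have := k.cast_nonneg (α := ℝ); linarith
            have h2 : (0 : ℝ) ≤ 2 / (k + 1) := by positivity
            calc ‖Xs k ω‖ ^ p * (2 / (k + 1)) ≤ C * 2 := by gcongr
              _ = _ := by ring)
        exact this.trans (add_le_add_left hω _))
      (fun k hk ω hω hkD => by
        have := tsum_slWeight_one_le_add (fun j => by positivity) (z := ‖Xs k ω‖ ^ p)
          (by positivity) k (fun j => (norm_partialSum_rpow_le_erase hp.le hp1 Xs k j ω).1)
          (K := 2) (by
            have h1 : ((m + 1 : ℕ) : ℝ) ≤ k := by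
              exact_mod_cast (Finset.mem_Ico.1 hk).1
            have h2 : ‖Xs k ω‖ ^ p ≤ k + 1 := hkD.2.trans (by linarith)
            rw [mul_div_assoc', div_le_iff₀ (by positivity)]
            linarith)
        exact this.trans (add_le_add_left hω _))
      (fun ω hω => by
        refine le_trans (show F ω ≤ M from hω) ?_
        rw [hM₂, hM₁, add_assoc]
        exact le_self_add)
    have e : X ⁻¹' {x : B | t < ‖x‖ ^ p ∧ ‖x‖ ^ p ≤ (m + 1 : ℕ)} =
      {ω | t < ‖X ω‖ ^ p ∧ ‖X ω‖ ^ p ≤ (m + 1 : ℕ)} := rfl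
    have hcard : (Finset.Ico (m + 1) (2 * m + 1 + 1)).card = m + 1 := by simp; omega
    rw [hcard, e] at h2
    have hset : {ω | t < 3 * ‖partialSum Xs (2 * m + 1 + 1) ω‖ ^ p} =
        {ω | t / 3 < ‖partialSum Xs (2 * m + 1 + 1) ω‖ ^ p} := by
      ext ω; simp only [Set.mem_ofPred_eq]; constructor <;> intro h <;> linarith
    have hcap : cappedTail μ (fun ω => ‖X ω‖ ^ p) (m + 1) t = ENNReal.ofReal
        (min 1 (((m + 1 : ℕ) : ℝ) * μ.real {ω | t < ‖X ω‖ ^ p ∧ ‖X ω‖ ^ p ≤ (m + 1 : ℕ)})) := by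
      rw [cappedTail, ENNReal.ofReal_min, ENNReal.ofReal_one,
        ENNReal.ofReal_mul (by positivity), ENNReal.ofReal_natCast, ofReal_measureReal]
    simp only [hset, hw]
    rw [hcap]
    have hfin := ENNReal.ofReal_le_ofReal h2
    rw [ofReal_measureReal, ENNReal.ofReal_mul (by norm_num)] at hfin
    calc _ = ENNReal.ofReal (1 / 4) * slWeight 1 m * (ENNReal.ofReal (1 / 16) * ENNReal.ofReal
          (min 1 (((m + 1 : ℕ) : ℝ) *
            μ.real {ω | t < ‖X ω‖ ^ p ∧ ‖X ω‖ ^ p ≤ (m + 1 : ℕ)}))) := by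
          have : κ = ENNReal.ofReal (1 / 4) * ENNReal.ofReal (1 / 16) := by
            rw [hκ, ← ENNReal.ofReal_mul (by norm_num)]; norm_num
          rw [this]; ring
      _ ≤ _ := by gcongr
  have hfin : ∫⁻ t in Set.Ioi (3 * C), ∑' m : ℕ, slWeight 1 m *
        cappedTail μ (fun ω => ‖X ω‖ ^ p) (m + 1) t < ⊤ := by
    have hmeas : Measurable fun t : ℝ => ∑' m : ℕ, slWeight 1 m *
        cappedTail μ (fun ω => ‖X ω‖ ^ p) (m + 1) t :=
      Measurable.tsum fun m => (measurable_cappedTail _ _ _).const_mul _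
    have h4 : κ * ∫⁻ t in Set.Ioi (3 * C), ∑' m : ℕ, slWeight 1 m *
        cappedTail μ (fun ω => ‖X ω‖ ^ p) (m + 1) t ≤ 3 * M₂ := by
      rw [← lintegral_const_mul _ hmeas]
      refine (setLIntegral_mono' measurableSet_Ioi hlow).trans (le_trans ?_ hint)
      exact lintegral_mono_set (Set.Ioi_subset_Ioi (by linarith))
    by_contra hcon
    rw [not_lt, top_le_iff] at hcon
    rw [hcon, ENNReal.mul_top (by rw [hκ]; simp), top_le_iff] at h4
    exact ENNReal.mul_ne_top (by simp) hM₂top h4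
  have h3C : 0 ≤ 3 * C := by linarith
  rw [← Set.Ioc_union_Ioi_eq_Ioi h3C]
  refine (lintegral_union_le _ _ _).trans_lt (ENNReal.add_lt_top.2 ⟨?_, hfin⟩)
  calc _ ≤ ∫⁻ t in Set.Ioc 0 (3 * C), ∑' m : ℕ, slWeight 1 m := by
        refine lintegral_mono fun t => ENNReal.tsum_le_tsum fun m => ?_
        exact mul_le_of_le_one_right' (min_le_left _ _)
    _ < ⊤ := by
        rw [setLIntegral_const]
        exact ENNReal.mul_lt_top tsum_slWeight_one_lt_top measure_Ioc_lt_top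

/-! ### Quantiles and the truncated moment -/

theorem bddBelow_quantile_set {Ω : Type*} [MeasurableSpace Ω] (μ : Measure Ω)
    {Y : Ω → ℝ} (hY0 : ∀ ω, 0 ≤ Y ω) {α : ℝ} (hα : 0 ≤ α) :
    0 ∈ lowerBounds {t : ℝ | α < μ.real {ω | Y ω ≤ t}} := by
  intro t ht
  by_contra h
  push Not at h
  have : {ω | Y ω ≤ t} = ∅ := by
    ext ω; simp only [Set.mem_ofPred_eq, Set.mem_empty_iff_false, iff_false, not_le]
    exact h.trans_le (hY0 ω)
  simp only [Set.mem_ofPred_eq, this, measureReal_empty] at ht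
  linarith

theorem quantile_nonneg {Ω : Type*} [MeasurableSpace Ω] (μ : Measure Ω)
    {Y : Ω → ℝ} (hY0 : ∀ ω, 0 ≤ Y ω) {α : ℝ} (hα : 0 ≤ α) : 0 ≤ quantile μ Y α :=
  Real.sInf_nonneg fun _ ht => bddBelow_quantile_set μ hY0 hα ht

theorem quantile_set_nonempty {Ω : Type*} [MeasurableSpace Ω] (μ : Measure Ω)
    [IsProbabilityMeasure μ] {Y : Ω → ℝ} (hY : Measurable Y) {α : ℝ} (hα : α < 1) :
    {t : ℝ | α < μ.real {ω | Y ω ≤ t}}.Nonempty := by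
  obtain ⟨M, -, hM⟩ := exists_measureReal_real_gt_le μ hY (ε := (1 - α) / 2) (by linarith)
  refine ⟨M, ?_⟩
  have h1 := probReal_compl_eq_one_sub (μ := μ) (measurableSet_lt measurable_const hY : MeasurableSet {ω | M < Y ω})
  have h2 : {ω | M < Y ω}ᶜ = {ω | Y ω ≤ M} := by ext; simp
  rw [h2] at h1
  simp only [Set.mem_ofPred_eq, h1]
  linarith

theorem quantile_mono {Ω : Type*} [MeasurableSpace Ω] (μ : Measure Ω)
    [IsProbabilityMeasure μ] {Y : Ω → ℝ} (hY : Measurable Y) (hY0 : ∀ ω, 0 ≤ Y ω) {α β : ℝ}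
    (hα : 0 ≤ α) (hαβ : α ≤ β) (hβ : β < 1) : quantile μ Y α ≤ quantile μ Y β :=
  csInf_le_csInf ⟨0, bddBelow_quantile_set μ hY0 hα⟩ (quantile_set_nonempty μ hY hβ)
    fun _ ht => hαβ.trans_lt ht

/-- Each level strictly above the infimum dominates a member of the defining set; continuity of the
measure along increasing events then reaches the infimum itself. -/
theorem measure_quantile_lt_le {Ω : Type*} [MeasurableSpace Ω] (μ : Measure Ω)
    [IsProbabilityMeasure μ] {Y : Ω → ℝ} (hY : Measurable Y) {α : ℝ} (hα1 : α < 1) :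
    μ {ω | quantile μ Y α < Y ω} ≤ ENNReal.ofReal (1 - α) := by
  have e : {ω | quantile μ Y α < Y ω} = ⋃ k : ℕ, {ω | quantile μ Y α + 1 / (k + 1) < Y ω} := by
    ext ω
    simp only [Set.mem_ofPred_eq, Set.mem_iUnion]
    constructor
    · intro h
      obtain ⟨k, hk⟩ := exists_nat_one_div_lt (sub_pos.2 h)
      exact ⟨k, by linarith⟩
    · rintro ⟨k, hk⟩
      have : (0 : ℝ) < 1 / (k + 1) := by positivity
      linarith
  rw [e, Directed.measure_iUnion]
  · refine iSup_le fun k => ?_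
    obtain ⟨t, ht, htlt⟩ := exists_lt_of_csInf_lt (quantile_set_nonempty μ hY hα1)
      (show quantile μ Y α < quantile μ Y α + 1 / (k + 1) by
        have : (0 : ℝ) < 1 / (k + 1) := by positivity
        linarith)
    simp only [Set.mem_ofPred_eq] at ht
    rw [← ofReal_measureReal (μ := μ)]
    refine ENNReal.ofReal_le_ofReal ?_
    have h1 : μ.real {ω | quantile μ Y α + 1 / (k + 1) < Y ω} ≤ μ.real {ω | Y ω ≤ t}ᶜ := by
      refine measureReal_mono (fun ω hω h => ?_) (measure_ne_top _ _)
      simp only [Set.mem_ofPred_eq] at hω h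
      linarith
    have h2 := probReal_compl_eq_one_sub (μ := μ)
      (measurableSet_le hY measurable_const : MeasurableSet {ω | Y ω ≤ t})
    linarith
  · refine Monotone.directed_le fun a b hab ω hω => ?_
    simp only [Set.mem_ofPred_eq] at hω ⊢
    have : (1 : ℝ) / (b + 1) ≤ 1 / (a + 1) := by gcongr
    linarith

theorem le_measure_of_lt_quantile {Ω : Type*} [MeasurableSpace Ω] (μ : Measure Ω)
    [IsProbabilityMeasure μ] {Y : Ω → ℝ} (hY : Measurable Y) (hY0 : ∀ ω, 0 ≤ Y ω) {α t : ℝ}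
    (hα : 0 ≤ α) (ht : t < quantile μ Y α) :
    ENNReal.ofReal (1 - α) ≤ μ {ω | t < Y ω} := by
  have h : ¬ α < μ.real {ω | Y ω ≤ t} :=
    fun h => notMem_of_lt_csInf ht ⟨0, bddBelow_quantile_set μ hY0 hα⟩ h
  have h2 := probReal_compl_eq_one_sub (μ := μ)
    (measurableSet_le hY measurable_const : MeasurableSet {ω | Y ω ≤ t})
  have h3 : {ω | Y ω ≤ t}ᶜ = {ω | t < Y ω} := by ext; simp
  rw [h3] at h2
  rw [← ofReal_measureReal (μ := μ)]
  exact ENNReal.ofReal_le_ofReal (by linarith)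

theorem one_sub_one_div_nonneg {n : ℕ} (hn : 1 ≤ n) : (0 : ℝ) ≤ 1 - 1 / n := by
  have : (1 : ℝ) ≤ n := by exact_mod_cast hn
  rw [sub_nonneg, div_le_one (by linarith)]
  exact this

theorem one_sub_one_div_lt_one {n : ℕ} (hn : 1 ≤ n) : (1 : ℝ) - 1 / n < 1 := by
  have : (0 : ℝ) < n := by exact_mod_cast hn
  have : (0 : ℝ) < 1 / n := by positivity
  linarith

theorem normQuantile_nonneg {Ω B : Type*} [MeasurableSpace Ω] (μ : Measure Ω) [NormedAddCommGroup B]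
    {n : ℕ} (hn : 1 ≤ n) (X : Ω → B) : 0 ≤ normQuantile μ X n :=
  quantile_nonneg μ (fun _ => norm_nonneg _) (one_sub_one_div_nonneg hn)

/-- The minimum only makes the truncation range empty when `u_n^p ≥ n`; inside the range the norm
really exceeds the quantile. -/
theorem normQuantile_lt_of_min_lt {Ω B : Type*} [MeasurableSpace Ω] (μ : Measure Ω) [NormedAddCommGroup B]
    {X : Ω → B} {p : ℝ} (hp : 0 < p) {n : ℕ} {ω : Ω}
    (h : min (normQuantile μ X n ^ p) (n : ℝ) < ‖X ω‖ ^ p) (h' : ‖X ω‖ ^ p ≤ (n : ℝ)) :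
    normQuantile μ X n < ‖X ω‖ := by
  rcases min_lt_iff.1 h with h | h
  · by_contra hc
    push Not at hc
    exact absurd (Real.rpow_le_rpow (norm_nonneg _) hc hp.le) (not_le.2 h)
  · exact absurd h' (not_le.2 h)

section NormQuantile

variable {Ω : Type*} [MeasurableSpace Ω] (μ : Measure Ω) [IsProbabilityMeasure μ]
  {B : Type*} [NormedAddCommGroup B] [MeasurableSpace B] [BorelSpace B] {X : Ω → B}

theorem normQuantile_mono (hX : Measurable X) {m n : ℕ} (hm : 1 ≤ m) (hmn : m ≤ n) :
    normQuantile μ X m ≤ normQuantile μ X n := by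
  refine quantile_mono μ hX.norm (fun _ => norm_nonneg _) (one_sub_one_div_nonneg hm) ?_
    (one_sub_one_div_lt_one (hm.trans hmn))
  have : (0 : ℝ) < m := by exact_mod_cast hm
  gcongr

theorem measure_normQuantile_lt_le (hX : Measurable X) {n : ℕ} (hn : 1 ≤ n) :
    μ {ω | normQuantile μ X n < ‖X ω‖} ≤ (n : ENNReal)⁻¹ := by
  refine (measure_quantile_lt_le μ hX.norm (one_sub_one_div_lt_one hn)).trans (le_of_eq ?_)
  have : (0 : ℝ) < n := by exact_mod_cast hn
  rw [sub_sub_cancel, one_div, ENNReal.ofReal_inv_of_pos this, ENNReal.ofReal_natCast]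

theorem le_measure_of_lt_normQuantile (hX : Measurable X) {n : ℕ} (hn : 1 ≤ n) {t : ℝ}
    (ht : t < normQuantile μ X n) : (n : ENNReal)⁻¹ ≤ μ {ω | t < ‖X ω‖} := by
  refine le_trans (le_of_eq ?_)
    (le_measure_of_lt_quantile μ hX.norm (fun _ => norm_nonneg _) (one_sub_one_div_nonneg hn) ht)
  have : (0 : ℝ) < n := by exact_mod_cast hn
  rw [sub_sub_cancel, one_div, ENNReal.ofReal_inv_of_pos this, ENNReal.ofReal_natCast]

theorem ofReal_truncatedMoment (hX : Measurable X) (p : ℝ) (n : ℕ) :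
    ENNReal.ofReal (truncatedMoment μ X p n) =
      ∫⁻ ω, ENNReal.ofReal ({ω | min (normQuantile μ X n ^ p) (n : ℝ) < ‖X ω‖ ^ p ∧
        ‖X ω‖ ^ p ≤ (n : ℝ)}.indicator (fun ω => ‖X ω‖ ^ p) ω) ∂μ := by
  have hZ : Measurable fun ω => ‖X ω‖ ^ p := hX.norm.pow_const p
  have hE : MeasurableSet {ω | min (normQuantile μ X n ^ p) (n : ℝ) < ‖X ω‖ ^ p ∧
        ‖X ω‖ ^ p ≤ (n : ℝ)} :=
    (measurableSet_lt measurable_const hZ).inter (measurableSet_le hZ measurable_const)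
  have h0 : ∀ ω, 0 ≤ {ω | min (normQuantile μ X n ^ p) (n : ℝ) < ‖X ω‖ ^ p ∧
        ‖X ω‖ ^ p ≤ (n : ℝ)}.indicator (fun ω => ‖X ω‖ ^ p) ω := fun ω =>
    Set.indicator_nonneg (fun ω _ => by positivity) ω
  rw [truncatedMoment, ofReal_integral_eq_lintegral_ofReal _ (Filter.Eventually.of_forall h0)]
  refine Integrable.of_bound (C := n) (hZ.indicator hE).aestronglyMeasurable
    (Filter.Eventually.of_forall fun ω => ?_)
  rw [Real.norm_of_nonneg (h0 ω)]
  by_cases h : ω ∈ {ω | min (normQuantile μ X n ^ p) (n : ℝ) < ‖X ω‖ ^ p ∧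
        ‖X ω‖ ^ p ≤ (n : ℝ)}
  · rw [Set.indicator_of_mem h]; exact h.2
  · rw [Set.indicator_of_notMem h]; positivity

/-- By the layer-cake formula it suffices to bound `n` times a tail probability by both terms of the
minimum. The bound by `1` is where the quantile enters: `n P(‖X‖ > u_n) ≤ 1`. -/
theorem mul_ofReal_truncatedMoment_le (hX : Measurable X) {p : ℝ} (hp : 0 < p) {n : ℕ}
    (hn : 1 ≤ n) : (n : ENNReal) * ENNReal.ofReal (truncatedMoment μ X p n) ≤
      ∫⁻ t in Set.Ioi (0 : ℝ), cappedTail μ (fun ω => ‖X ω‖ ^ p) n t := by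
  have hZ : Measurable fun ω => ‖X ω‖ ^ p := hX.norm.pow_const p
  set E := {ω | min (normQuantile μ X n ^ p) (n : ℝ) < ‖X ω‖ ^ p ∧ ‖X ω‖ ^ p ≤ (n : ℝ)} with hEdef
  have hE : MeasurableSet E :=
    (measurableSet_lt measurable_const hZ).inter (measurableSet_le hZ measurable_const)
  have hn0 : (n : ENNReal) ≠ 0 := by simp; omega
  rw [ofReal_truncatedMoment μ hX p, lintegral_eq_lintegral_meas_lt _
    (Filter.Eventually.of_forall fun ω => Set.indicator_nonneg (fun ω _ => by positivity) ω)
    (hZ.indicator hE).aemeasurable, ← lintegral_const_mul']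
  · refine setLIntegral_mono' measurableSet_Ioi fun t ht => ?_
    have hsub : {ω | t < E.indicator (fun ω => ‖X ω‖ ^ p) ω} ⊆
        {ω | t < ‖X ω‖ ^ p ∧ ‖X ω‖ ^ p ≤ n} ∩ {ω | normQuantile μ X n < ‖X ω‖} := by
      intro ω hω
      by_cases h : ω ∈ E
      · simp only [Set.mem_ofPred_eq, Set.indicator_of_mem h] at hω
        exact ⟨⟨hω, h.2⟩, normQuantile_lt_of_min_lt μ hp h.1 h.2⟩
      · simp only [Set.mem_ofPred_eq, Set.indicator_of_notMem h] at hω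
        exact absurd hω (not_lt.2 (le_of_lt ht))
    refine le_min ?_ ?_
    · calc _ ≤ (n : ENNReal) * (n : ENNReal)⁻¹ := by
            gcongr
            exact (measure_mono (hsub.trans Set.inter_subset_right)).trans
              (measure_normQuantile_lt_le μ hX hn)
        _ = 1 := ENNReal.mul_inv_cancel hn0 (by simp)
    · exact mul_le_mul_right (measure_mono (hsub.trans Set.inter_subset_left)) _
  · simp

end NormQuantile

/-! ### Dyadic blocks and the two necessary conditions for `q = p` -/

theorem tsum_succ_eq_tsum_sum_Ico_two_pow (f : ℕ → ENNReal) :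
    ∑' n : ℕ, f (n + 1) = ∑' j : ℕ, ∑ n ∈ Finset.Ico (2 ^ j) (2 ^ (j + 1)), f n := by
  have h1 := ENNReal.tendsto_nat_tsum fun j : ℕ => ∑ n ∈ Finset.Ico (2 ^ j) (2 ^ (j + 1)), f n
  have e : ∀ J : ℕ, ∑ j ∈ Finset.range J, ∑ n ∈ Finset.Ico (2 ^ j) (2 ^ (j + 1)), f n =
      ∑ n ∈ Finset.range (2 ^ J - 1), f (n + 1) := by
    intro J
    have h2 : ∑ j ∈ Finset.range J, ∑ n ∈ Finset.Ico (2 ^ j) (2 ^ (j + 1)), f n =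
        ∑ n ∈ Finset.Ico 1 (2 ^ J), f n := by
      induction J with
      | zero => simp
      | succ J ih =>
        rw [Finset.sum_range_succ, ih]
        exact Finset.sum_Ico_consecutive _ Nat.one_le_two_pow
          (Nat.pow_le_pow_right (by norm_num) (Nat.le_succ J))
    rw [h2, Finset.sum_Ico_eq_sum_range]
    exact Finset.sum_congr rfl fun n _ => by rw [add_comm]
  simp_rw [e] at h1
  refine tendsto_nhds_unique ((ENNReal.tendsto_nat_tsum fun n => f (n + 1)).comp ?_) h1
  refine Filter.tendsto_atTop_mono (fun J => ?_) Filter.tendsto_id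
  have := Nat.lt_two_pow_self (n := J)
  simp only [id]; omega

/-- The capped terms tend to zero, so the cap is active for only finitely many indices. -/
theorem ENNReal.tsum_lt_top_of_tsum_min_one_lt_top {f : ℕ → ENNReal} (hf : ∀ j, f j ≠ ⊤)
    (h : ∑' j, min 1 (f j) < ⊤) : ∑' j, f j < ⊤ := by
  have h0 := ENNReal.tendsto_atTop_zero_of_tsum_ne_top h.ne
  obtain ⟨N, hN⟩ := Filter.eventually_atTop.1
    ((tendsto_order.1 h0).2 1 (by norm_num))
  rw [← ENNReal.summable.sum_add_tsum_nat_add' (k := N)]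
  refine ENNReal.add_lt_top.2 ⟨ENNReal.sum_lt_top.2 fun j _ => (hf j).lt_top, ?_⟩
  refine lt_of_le_of_lt (ENNReal.tsum_le_tsum fun j => ?_)
    (lt_of_le_of_lt (ENNReal.tsum_comp_le_tsum_of_injective
      (add_left_injective N) fun j => min 1 (f j)) h)
  have := hN (j + N) (Nat.le_add_left _ _)
  rcases min_lt_iff.1 this with h | h
  · exact absurd h (lt_irrefl _)
  · exact le_min h.le le_rfl

/-- For `n` in `[2^j, 2^{j+1})` and `t ≤ 2^j/2`, the capped tail is at least `min(1, 2^j P(2^j/2 < Z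
≤ 2^j))`. Multiplying the number of such `n`, the least weight and the length of the `t`-interval
gives `2^j · 2^{-2(j+1)} · 2^j/2 = 1/8`. Once the cap is removed, the sum over `j` dominates the
expectation of `Z` beyond `1`. -/
theorem lintegral_ofReal_lt_top_of_cappedTail {Ω : Type*} [MeasurableSpace Ω] (μ : Measure Ω)
    [IsProbabilityMeasure μ] {Z : Ω → ℝ} (hZ : Measurable Z)
    (h : ∑' m : ℕ, slWeight 1 m * ∫⁻ t in Set.Ioi (0 : ℝ), cappedTail μ Z (m + 1) t < ⊤) :
    ∫⁻ ω, ENNReal.ofReal (Z ω) ∂μ < ⊤ := by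
  set E : ℕ → Set Ω := fun j => {ω | (2 : ℝ) ^ j / 2 < Z ω ∧ Z ω ≤ 2 ^ j} with hEdef
  have hE : ∀ j, MeasurableSet (E j) := fun j =>
    (measurableSet_lt measurable_const hZ).inter (measurableSet_le hZ measurable_const)
  have hblock : ∀ j : ℕ, ENNReal.ofReal (1 / 8) * min 1 (2 ^ j * μ (E j)) ≤
      ∑ n ∈ Finset.Ico (2 ^ j : ℕ) (2 ^ (j + 1)), ENNReal.ofReal ((n : ℝ) ^ (-(1 + 1) : ℝ)) *
        ∫⁻ t in Set.Ioi (0 : ℝ), cappedTail μ Z n t := by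
    intro j
    have hterm : ∀ n ∈ Finset.Ico (2 ^ j : ℕ) (2 ^ (j + 1)),
        ENNReal.ofReal ((2 ^ (j + 1) : ℝ) ^ (-(1 + 1) : ℝ)) *
          (ENNReal.ofReal (2 ^ j / 2) * min 1 (2 ^ j * μ (E j))) ≤
        ENNReal.ofReal ((n : ℝ) ^ (-(1 + 1) : ℝ)) *
          ∫⁻ t in Set.Ioi (0 : ℝ), cappedTail μ Z n t := by
      intro n hn
      rw [Finset.mem_Ico] at hn
      have hn1 : (2 : ℝ) ^ j ≤ n := by exact_mod_cast hn.1
      have hn2 : (n : ℝ) ≤ 2 ^ (j + 1) := by exact_mod_cast hn.2.le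
      have hn0 : (0 : ℝ) < n := lt_of_lt_of_le (by positivity) hn1
      refine mul_le_mul' (ENNReal.ofReal_le_ofReal
        (Real.rpow_le_rpow_of_nonpos hn0 hn2 (by norm_num))) ?_
      calc ENNReal.ofReal (2 ^ j / 2) * min 1 (2 ^ j * μ (E j))
          = ∫⁻ t in Set.Ioc (0 : ℝ) (2 ^ j / 2), min 1 (2 ^ j * μ (E j)) := by
            rw [setLIntegral_const, Real.volume_Ioc, sub_zero, mul_comm]
        _ ≤ ∫⁻ t in Set.Ioc (0 : ℝ) (2 ^ j / 2), cappedTail μ Z n t := by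
            refine setLIntegral_mono' measurableSet_Ioc fun t ht => ?_
            unfold cappedTail
            refine min_le_min le_rfl (mul_le_mul' (by exact_mod_cast hn.1) (measure_mono ?_))
            intro ω hω
            exact ⟨lt_of_le_of_lt ht.2 hω.1, hω.2.trans hn1⟩
        _ ≤ _ := lintegral_mono_set Set.Ioc_subset_Ioi_self
    refine le_trans (le_of_eq ?_) (Finset.sum_le_sum hterm)
    rw [Finset.sum_const, Nat.card_Ico, nsmul_eq_mul, ← mul_assoc, ← mul_assoc]
    congr 1
    have e : (2 ^ (j + 1) - 2 ^ j : ℕ) = 2 ^ j := by rw [pow_succ]; omega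
    rw [e, ← ENNReal.ofReal_natCast, ← ENNReal.ofReal_mul (by positivity),
      ← ENNReal.ofReal_mul (by positivity)]
    congr 1
    have e2 : (2 ^ (j + 1) : ℝ) ^ (-(1 + 1) : ℝ) = ((2 ^ (j + 1) : ℝ) ^ 2)⁻¹ := by
      rw [Real.rpow_neg (by positivity)]; norm_num
    rw [e2]
    push_cast
    rw [pow_succ]
    field_simp
    ring
  have hsum : ∑' j : ℕ, min 1 (2 ^ j * μ (E j)) < ⊤ := by
    have h1 : ENNReal.ofReal (1 / 8) * ∑' j : ℕ, min 1 (2 ^ j * μ (E j)) < ⊤ := by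
      rw [← ENNReal.tsum_mul_left]
      refine lt_of_le_of_lt (ENNReal.tsum_le_tsum hblock) ?_
      rw [← tsum_succ_eq_tsum_sum_Ico_two_pow (fun n => ENNReal.ofReal ((n : ℝ) ^ (-(1 + 1) : ℝ)) *
        ∫⁻ t in Set.Ioi (0 : ℝ), cappedTail μ Z n t)]
      exact h
    by_contra hcon
    rw [not_lt, top_le_iff] at hcon
    rw [hcon, ENNReal.mul_top (by simp)] at h1
    exact lt_irrefl _ h1
  have hsum' := ENNReal.tsum_lt_top_of_tsum_min_one_lt_top
    (fun j => ENNReal.mul_ne_top (by simp) (measure_ne_top _ _)) hsum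
  calc ∫⁻ ω, ENNReal.ofReal (Z ω) ∂μ
      ≤ ∫⁻ ω, (1 + ∑' j : ℕ, (E j).indicator (fun _ => (2 : ENNReal) ^ j) ω) ∂μ := by
        refine lintegral_mono fun ω => ?_
        by_cases h1 : Z ω ≤ 1
        · refine le_trans ?_ le_self_add
          rw [← ENNReal.ofReal_one]
          exact ENNReal.ofReal_le_ofReal h1
        · push Not at h1
          have hex : ∃ j : ℕ, Z ω ≤ 2 ^ j := (pow_unbounded_of_one_lt (Z ω) one_lt_two).imp
            fun _ h => h.le
          classical
          set j := Nat.find hex with hj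
          have hj1 : Z ω ≤ 2 ^ j := Nat.find_spec hex
          have hj0 : j ≠ 0 := by
            intro h0; rw [h0, pow_zero] at hj1; linarith
          have hj2 : ¬ Z ω ≤ 2 ^ (j - 1) := Nat.find_min hex (by omega)
          have hmem : ω ∈ E j := by
            refine ⟨?_, hj1⟩
            push Not at hj2
            have : (2 : ℝ) ^ j / 2 = 2 ^ (j - 1) := by
              obtain ⟨i, hi⟩ := Nat.exists_eq_succ_of_ne_zero hj0
              rw [hi, pow_succ]; simp
            linarith
          refine le_trans ?_ le_add_self
          refine le_trans ?_ (ENNReal.le_tsum j)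
          rw [Set.indicator_of_mem hmem]
          refine (ENNReal.ofReal_le_ofReal hj1).trans (le_of_eq ?_)
          rw [ENNReal.ofReal_pow (by norm_num), ENNReal.ofReal_ofNat]
    _ = 1 + ∑' j : ℕ, 2 ^ j * μ (E j) := by
        rw [lintegral_add_left measurable_const, lintegral_tsum fun j =>
          (measurable_const.indicator (hE j)).aemeasurable]
        simp [lintegral_indicator_const (hE _)]
    _ < ⊤ := ENNReal.add_lt_top.2 ⟨by simp, hsum'⟩

theorem integrable_and_summable_of_pqTypeSLLN
    {Ω : Type*} [MeasurableSpace Ω] (μ : Measure Ω) [IsProbabilityMeasure μ]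
    {B : Type*} [NormedAddCommGroup B]
    [SecondCountableTopology B] [MeasurableSpace B] [BorelSpace B]
    {p : ℝ} (hp : 0 < p) (hp1 : p ≤ 1)
    {X : Ω → B} {Xs : ℕ → Ω → B}
    (hX : Measurable X) (hXs : ∀ n, Measurable (Xs n))
    (hindep : iIndepFun Xs μ) (hident : ∀ n, IdentDistrib (Xs n) X μ μ)
    (h : PQTypeSLLN μ Xs p p) :
    Integrable (fun ω => ‖X ω‖ ^ p) μ ∧
      Summable fun n : ℕ => truncatedMoment μ X p (n + 1) / ((n + 1 : ℕ) : ℝ) := by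
  have h1 := lintegral_tsum_cappedTail_lt_top μ hp hp1 hX hXs hindep hident h
  have hZ : Measurable fun ω => ‖X ω‖ ^ p := hX.norm.pow_const p
  rw [lintegral_tsum fun m => ((measurable_cappedTail _ _ _).const_mul _).aemeasurable] at h1
  simp_rw [lintegral_const_mul _ (measurable_cappedTail _ _ _)] at h1
  constructor
  · refine ⟨hZ.aestronglyMeasurable, ?_⟩
    rw [hasFiniteIntegral_iff_ofReal (Filter.Eventually.of_forall fun ω => by positivity)]
    exact lintegral_ofReal_lt_top_of_cappedTail μ hZ h1
  · have h0 : ∀ n, 0 ≤ truncatedMoment μ X p n := fun n =>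
      integral_nonneg fun ω => Set.indicator_nonneg (fun ω _ => by positivity) ω
    have h2 : ∑' n : ℕ, ENNReal.ofReal (truncatedMoment μ X p (n + 1) / ((n + 1 : ℕ) : ℝ)) < ⊤ := by
      refine lt_of_le_of_lt (ENNReal.tsum_le_tsum fun n => ?_) h1
      refine le_trans (le_of_eq ?_) (mul_le_mul_right
        (mul_ofReal_truncatedMoment_le μ hX hp (Nat.le_add_left 1 n)) _)
      rw [slWeight, ← ENNReal.ofReal_natCast, ← ENNReal.ofReal_mul (by positivity),
        ← ENNReal.ofReal_mul (by positivity)]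
      congr 1
      rw [Real.rpow_neg (by positivity)]
      norm_num
      field_simp
    refine (ENNReal.summable_toReal h2.ne).congr fun n => ?_
    rw [ENNReal.toReal_ofReal (div_nonneg (h0 _) (by positivity))]

/-! ### Moment bounds for truncated sums of norms -/

theorem ENNReal.rpow_finsetSum_le {ι : Type*} {q : ℝ} (hq : 0 < q) (hq1 : q ≤ 1) (s : Finset ι)
    (f : ι → ENNReal) : (∑ i ∈ s, f i) ^ q ≤ ∑ i ∈ s, f i ^ q := by
  classical
  induction s using Finset.induction_on with
  | empty => simp [hq]
  | insert a s ha ih =>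
    rw [Finset.sum_insert ha, Finset.sum_insert ha]
    exact (ENNReal.rpow_add_le_add_rpow _ _ hq.le hq1).trans (add_le_add_right ih _)

theorem lintegral_rpow_le_rpow_lintegral {Ω : Type*} [MeasurableSpace Ω] (μ : Measure Ω)
    [IsProbabilityMeasure μ] {q : ℝ} (hq : 0 < q) (hq1 : q ≤ 1) {f : Ω → ENNReal}
    (hf : Measurable f) : ∫⁻ ω, f ω ^ q ∂μ ≤ (∫⁻ ω, f ω ∂μ) ^ q := by
  have h := eLpNorm'_le_eLpNorm'_of_exponent_le hq hq1 μ hf.aestronglyMeasurable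
  simp only [eLpNorm', enorm_eq_self, ENNReal.rpow_one, div_one] at h
  have h2 := ENNReal.rpow_le_rpow h hq.le
  rwa [← ENNReal.rpow_mul, one_div_mul_cancel hq.ne', ENNReal.rpow_one] at h2

theorem ofReal_norm_rpow {B : Type*} [NormedAddCommGroup B] {q : ℝ} (hq : 0 ≤ q) (x : B) :
    ENNReal.ofReal (‖x‖ ^ q) = ‖x‖ₑ ^ q := by
  rw [← ENNReal.ofReal_rpow_of_nonneg (norm_nonneg _) hq, ofReal_norm]

/-- The sum of the norms of those among the first `N` variables that lie in `s`. -/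
noncomputable def truncNormSum {Ω B : Type*} [NormedAddCommGroup B] (Xs : ℕ → Ω → B) (s : Set B)
    (N : ℕ) (ω : Ω) : ENNReal :=
  ∑ k ∈ Finset.range N, s.indicator (fun x => ‖x‖ₑ) (Xs k ω)

theorem truncNormSum_mono {Ω B : Type*} [NormedAddCommGroup B] (Xs : ℕ → Ω → B) {s t : Set B}
    (hst : s ⊆ t) {N M : ℕ} (hNM : N ≤ M) (ω : Ω) :
    truncNormSum Xs s N ω ≤ truncNormSum Xs t M ω := by
  unfold truncNormSum
  refine le_trans (Finset.sum_le_sum fun k _ => ?_)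
    (Finset.sum_le_sum_of_subset (Finset.range_mono hNM))
  exact Set.indicator_le_indicator_of_subset hst (fun _ => zero_le) _

theorem enorm_partialSum_le_truncNormSum_univ {Ω B : Type*} [NormedAddCommGroup B]
    (Xs : ℕ → Ω → B) (N : ℕ) (ω : Ω) :
    ‖partialSum Xs N ω‖ₑ ≤ truncNormSum Xs Set.univ N ω := by
  simp only [truncNormSum, Set.indicator_univ]
  exact enorm_sum_le _ _

theorem truncNormSum_union_le {Ω B : Type*} [NormedAddCommGroup B] (Xs : ℕ → Ω → B)
    (s t : Set B) (N : ℕ) (ω : Ω) :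
    truncNormSum Xs (s ∪ t) N ω ≤ truncNormSum Xs s N ω + truncNormSum Xs t N ω := by
  rw [truncNormSum, truncNormSum, truncNormSum, ← Finset.sum_add_distrib]
  refine Finset.sum_le_sum fun k _ => ?_
  by_cases h : Xs k ω ∈ s
  · refine le_trans ?_ le_self_add
    simp [h]
  · refine le_trans ?_ le_add_self
    by_cases h' : Xs k ω ∈ t <;> simp [h, h']

section

variable {Ω : Type*} [MeasurableSpace Ω] (μ : Measure Ω) {B : Type*} [NormedAddCommGroup B]
  {X : Ω → B} {Xs : ℕ → Ω → B}

theorem measurable_truncNormSum {Ω B : Type*} [MeasurableSpace Ω] [NormedAddCommGroup B]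
    [MeasurableSpace B] [BorelSpace B] {Xs : ℕ → Ω → B} (hXs : ∀ n, Measurable (Xs n)) {s : Set B}
    (hs : MeasurableSet s) (N : ℕ) : Measurable (truncNormSum Xs s N) :=
  Finset.measurable_fun_sum _ fun k _ => (measurable_enorm.indicator hs).comp (hXs k)

theorem lintegral_truncNormSum_rpow_le [MeasurableSpace B] [BorelSpace B]
    (hident : ∀ n, IdentDistrib (Xs n) X μ μ) (hXs : ∀ n, Measurable (Xs n))
    {q : ℝ} (hq : 0 < q) (hq1 : q ≤ 1) {s : Set B} (hs : MeasurableSet s) (N : ℕ) :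
    ∫⁻ ω, truncNormSum Xs s N ω ^ q ∂μ ≤
      N * ∫⁻ ω, s.indicator (fun x => ‖x‖ₑ ^ q) (X ω) ∂μ := by
  have hm : Measurable (s.indicator fun x : B => ‖x‖ₑ ^ q) :=
    (measurable_enorm.pow_const q).indicator hs
  calc ∫⁻ ω, truncNormSum Xs s N ω ^ q ∂μ
      ≤ ∫⁻ ω, ∑ k ∈ Finset.range N, s.indicator (fun x => ‖x‖ₑ ^ q) (Xs k ω) ∂μ := by
        refine lintegral_mono fun ω => ?_
        refine (ENNReal.rpow_finsetSum_le hq hq1 _ _).trans (Finset.sum_le_sum fun k _ => ?_)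
        by_cases h : Xs k ω ∈ s <;> simp [h, hq]
    _ = ∑ k ∈ Finset.range N, ∫⁻ ω, s.indicator (fun x => ‖x‖ₑ ^ q) (Xs k ω) ∂μ :=
        lintegral_finsetSum _ fun k _ => hm.comp (hXs k)
    _ = ∑ k ∈ Finset.range N, ∫⁻ ω, s.indicator (fun x => ‖x‖ₑ ^ q) (X ω) ∂μ :=
        Finset.sum_congr rfl fun k _ => ((hident k).comp hm).lintegral_eq
    _ = _ := by simp

/-- Jensen's inequality puts the factor `N` inside the power, costing `N^q` instead of the `N` of
subadditivity. This gain is what makes the small norms summable. -/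
theorem lintegral_truncNormSum_rpow_le_rpow [IsProbabilityMeasure μ] [MeasurableSpace B] [BorelSpace B]
    (hident : ∀ n, IdentDistrib (Xs n) X μ μ) (hXs : ∀ n, Measurable (Xs n))
    {q : ℝ} (hq : 0 < q) (hq1 : q ≤ 1) {s : Set B} (hs : MeasurableSet s) (N : ℕ) :
    ∫⁻ ω, truncNormSum Xs s N ω ^ q ∂μ ≤
      (N * ∫⁻ ω, s.indicator (fun x => ‖x‖ₑ) (X ω) ∂μ) ^ q := by
  refine (lintegral_rpow_le_rpow_lintegral μ hq hq1 (measurable_truncNormSum hXs hs N)).trans ?_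
  have := lintegral_truncNormSum_rpow_le μ hident hXs one_pos le_rfl hs N
  simp only [ENNReal.rpow_one] at this
  gcongr

theorem lintegral_indicator_enorm_rpow_le [MeasurableSpace B]
    {v q : ℝ} (hq : 0 ≤ q) {s : Set B}
    (hsv : ∀ x ∈ s, ‖x‖ ≤ v) (hs : MeasurableSet s) (hX : Measurable X) :
    ∫⁻ ω, s.indicator (fun x => ‖x‖ₑ ^ q) (X ω) ∂μ ≤ ENNReal.ofReal v ^ q * μ (X ⁻¹' s) := by
  rw [← lintegral_indicator_const (hX hs)]
  refine lintegral_mono fun ω => ?_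
  by_cases h : X ω ∈ s
  · have h' : ω ∈ X ⁻¹' s := h
    simp only [Set.indicator_of_mem h, Set.indicator_of_mem h']
    rw [← ofReal_norm]
    gcongr
    exact hsv _ h
  · simp [h]

/-- The shell of vectors with norm in `(v (i - 1), v i]`, and the ball of radius `v 0` for
`i = 0`. -/
def normShell {B : Type*} [NormedAddCommGroup B] (v : ℕ → ℝ) : ℕ → Set B
  | 0 => {x | ‖x‖ ≤ v 0}
  | i + 1 => {x | v i < ‖x‖ ∧ ‖x‖ ≤ v (i + 1)}

theorem norm_le_of_mem_normShell {B : Type*} [NormedAddCommGroup B] {v : ℕ → ℝ} {i : ℕ} {x : B}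
    (h : x ∈ normShell v i) : ‖x‖ ≤ v i := by
  cases i with
  | zero => exact h
  | succ i => exact h.2

theorem exists_mem_normShell {B : Type*} [NormedAddCommGroup B] {v : ℕ → ℝ} {j : ℕ} {x : B}
    (h : ‖x‖ ≤ v j) : ∃ i ≤ j, x ∈ normShell v i := by
  classical
  have hex : ∃ i, ‖x‖ ≤ v i := ⟨j, h⟩
  refine ⟨Nat.find hex, Nat.find_min' hex h, ?_⟩
  rcases hi : Nat.find hex with _ | i
  · have := Nat.find_spec hex
    rwa [hi] at this
  · have h1 := Nat.find_spec hex
    rw [hi] at h1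
    exact ⟨not_le.1 (Nat.find_min hex (m := i) (by omega)), h1⟩

theorem measurableSet_normShell [MeasurableSpace B] [BorelSpace B]
    (v : ℕ → ℝ) (i : ℕ) : MeasurableSet (normShell v i : Set B) := by
  cases i with
  | zero => exact measurableSet_le (f := fun x : B => ‖x‖) measurable_norm measurable_const
  | succ i =>
    exact
      (measurableSet_lt (g := fun x : B => ‖x‖) measurable_const measurable_norm).inter
        (measurableSet_le measurable_norm measurable_const)

theorem measure_preimage_normShell_le [IsProbabilityMeasure μ]
    {v : ℕ → ℝ}
    (hv : ∀ i, μ {ω | v i < ‖X ω‖} ≤ ((2 : ENNReal) ^ i)⁻¹) (i : ℕ) :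
    μ (X ⁻¹' normShell v i) ≤ 2 * ((2 : ENNReal) ^ i)⁻¹ := by
  cases i with
  | zero =>
    refine prob_le_one.trans ?_
    norm_num
  | succ i =>
    refine (measure_mono (t := {ω | v i < ‖X ω‖}) fun ω h => h.1).trans ((hv i).trans ?_)
    rw [pow_succ, ENNReal.mul_inv (by simp) (by simp), mul_left_comm,
      ENNReal.mul_inv_cancel (by simp) (by simp), mul_one]

/-- Writing `v_i^q` as the length of `(0, v_i^q)` turns the sum into an integral over `t` of a
partial geometric series. At level `t` only indices with `2^{-i} ≤ P(‖X‖^q > t)` contribute. -/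
theorem tsum_mul_enorm_rpow_le {v : ℕ → ℝ} (hv0 : ∀ i, 0 ≤ v i)
    (hv : ∀ i t, t < v i → ((2 : ENNReal) ^ i)⁻¹ ≤ μ {ω | t < ‖X ω‖})
    {q α : ℝ} (hq : 0 < q) (hα : 0 < α) :
    ∑' i : ℕ, ((2 : ENNReal) ^ (-α)) ^ i * ENNReal.ofReal (v i) ^ q ≤
      (1 - (2 : ENNReal) ^ (-α))⁻¹ * ∫⁻ t in Set.Ioi (0 : ℝ), μ {ω | t < ‖X ω‖ ^ q} ^ α := by
  classical
  set r : ENNReal := (2 : ENNReal) ^ (-α) with hr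
  have hr1 : r < 1 := ENNReal.rpow_lt_one_of_one_lt_of_neg (by norm_num) (by linarith)
  have hterm : ∀ i, r ^ i * ENNReal.ofReal (v i) ^ q =
      ∫⁻ t in Set.Ioi (0 : ℝ), (Set.Iio (v i ^ q)).indicator (fun _ => r ^ i) t := by
    intro i
    rw [lintegral_indicator_const measurableSet_Iio, Measure.restrict_apply measurableSet_Iio,
      Set.inter_comm, Set.Ioi_inter_Iio, Real.volume_Ioo, sub_zero,
      ENNReal.ofReal_rpow_of_nonneg (hv0 i) hq.le]
  simp_rw [hterm]
  rw [← lintegral_tsum fun i => (measurable_const.indicator measurableSet_Iio).aemeasurable,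
    ← lintegral_const_mul' _ _ (by
      refine ENNReal.inv_ne_top.2 ?_
      exact (tsub_pos_of_lt hr1).ne')]
  refine setLIntegral_mono' measurableSet_Ioi fun t ht => ?_
  have ht0 : 0 < t := ht
  have hiff : ∀ i, t ∈ Set.Iio (v i ^ q) → ((2 : ENNReal) ^ i)⁻¹ ≤ μ {ω | t < ‖X ω‖ ^ q} := by
    intro i hi
    have h1 : t ^ (1 / q) < v i := by
      have h := Real.rpow_lt_rpow ht0.le hi (show 0 < 1 / q by positivity)
      rwa [← Real.rpow_mul (hv0 i), mul_one_div_cancel hq.ne', Real.rpow_one] at h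
    refine (hv i _ h1).trans (measure_mono fun ω hω => ?_)
    have h := Real.rpow_lt_rpow (by positivity) (show t ^ (1 / q) < ‖X ω‖ from hω) hq
    rwa [← Real.rpow_mul ht0.le, one_div_mul_cancel hq.ne', Real.rpow_one] at h
  by_cases hex : ∃ i, ((2 : ENNReal) ^ i)⁻¹ ≤ μ {ω | t < ‖X ω‖ ^ q}
  -- The series starts no earlier than `i₀`, hence is at most `r^{i₀}/(1 - r)`, and `r^{i₀} =
  -- (2^{-i₀})^α ≤ P(‖X‖^q > t)^α`.
  · set i₀ := Nat.find hex with hi₀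
    have hspec := Nat.find_spec hex
    rw [← hi₀] at hspec
    rw [← ENNReal.summable.sum_add_tsum_nat_add' (k := i₀), Finset.sum_eq_zero, zero_add]
    · calc ∑' i : ℕ, (Set.Iio (v (i + i₀) ^ q)).indicator (fun _ => r ^ (i + i₀)) t
          ≤ ∑' i : ℕ, r ^ i * r ^ i₀ := by
            refine ENNReal.tsum_le_tsum fun i => ?_
            rw [← pow_add]
            exact Set.indicator_le_self _ _ _
        _ = (1 - r)⁻¹ * r ^ i₀ := by rw [ENNReal.tsum_mul_right, ENNReal.tsum_geometric]
        _ ≤ _ := by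
            gcongr
            have h := ENNReal.rpow_le_rpow hspec hα.le
            refine le_trans (le_of_eq ?_) h
            rw [hr, ← ENNReal.rpow_natCast, ← ENNReal.rpow_mul, ← ENNReal.rpow_natCast,
              ← ENNReal.rpow_neg, ← ENNReal.rpow_mul]
            congr 1; ring
    · intro i hi
      rw [Finset.mem_range] at hi
      refine Set.indicator_of_notMem (fun h => ?_) _
      exact Nat.find_min hex hi (hiff i h)
  · refine le_trans (le_of_eq ?_) zero_le
    refine ENNReal.tsum_eq_zero.2 fun i => Set.indicator_of_notMem (fun h => ?_) _
    exact hex ⟨i, hiff i h⟩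

/-- The shell `i` has probability at most `2 · 2^{-i}`, so by Jensen its share at scale `j = i + l`
is at most a constant times `2^{-αi} v_i^q (2^{q-α})^l`. Summing first over `l` needs `q < α`. -/
theorem tsum_lintegral_truncNormSum_le_lt_top [IsProbabilityMeasure μ] [MeasurableSpace B] [BorelSpace B]
    (hX : Measurable X)
    (hident : ∀ n, IdentDistrib (Xs n) X μ μ) (hXs : ∀ n, Measurable (Xs n)) {v : ℕ → ℝ}
    (hv : ∀ i, μ {ω | v i < ‖X ω‖} ≤ ((2 : ENNReal) ^ i)⁻¹)
    {q α : ℝ} (hq : 0 < q) (hq1 : q ≤ 1) (hqα : q < α)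
    (hsum : ∑' i : ℕ, ((2 : ENNReal) ^ (-α)) ^ i * ENNReal.ofReal (v i) ^ q < ⊤) :
    ∑' j : ℕ, ((2 : ENNReal) ^ (-α)) ^ j *
      ∫⁻ ω, truncNormSum Xs {x | ‖x‖ ≤ v j} (2 ^ j) ω ^ q ∂μ < ⊤ := by
  classical
  set r : ENNReal := (2 : ENNReal) ^ (-α) with hr
  set g : ℕ → ENNReal := fun i => r ^ i * ENNReal.ofReal (v i) ^ q with hg
  have hshell : ∀ l i : ℕ, r ^ (i + l) *
      ∫⁻ ω, truncNormSum Xs (normShell v i) (2 ^ (i + l)) ω ^ q ∂μ ≤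
      2 ^ q * g i * (r * 2 ^ q) ^ l := by
    intro l i
    have h1 : ((2 ^ (i + l) : ℕ) : ENNReal) *
        ∫⁻ ω, (normShell v i).indicator (fun x => ‖x‖ₑ) (X ω) ∂μ ≤
        2 ^ l * 2 * ENNReal.ofReal (v i) := by
      have h2 := lintegral_indicator_enorm_rpow_le μ (X := X) zero_le_one
        (fun x hx => norm_le_of_mem_normShell (v := v) (i := i) hx)
        (measurableSet_normShell v i) hX
      simp only [ENNReal.rpow_one] at h2
      calc _ ≤ ((2 ^ (i + l) : ℕ) : ENNReal) *
            (ENNReal.ofReal (v i) * (2 * ((2 : ENNReal) ^ i)⁻¹)) := by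
            gcongr
            exact h2.trans (mul_le_mul_right (measure_preimage_normShell_le μ hv i) _)
        _ = (2 ^ i * ((2 : ENNReal) ^ i)⁻¹) * (2 ^ l * 2 * ENNReal.ofReal (v i)) := by
            push_cast; rw [pow_add]; ring
        _ = _ := by rw [ENNReal.mul_inv_cancel (by simp) (by simp), one_mul]
    calc _ ≤ r ^ (i + l) * (2 ^ l * 2 * ENNReal.ofReal (v i)) ^ q := by
          gcongr
          exact (lintegral_truncNormSum_rpow_le_rpow μ hident hXs hq hq1
            (measurableSet_normShell v i) _).trans (ENNReal.rpow_le_rpow h1 hq.le)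
      _ = _ := by
          rw [ENNReal.mul_rpow_of_nonneg _ _ hq.le, ENNReal.mul_rpow_of_nonneg _ _ hq.le, mul_pow,
            pow_add, hg, ← ENNReal.rpow_natCast (2 ^ q), ← ENNReal.rpow_natCast 2 l,
            ← ENNReal.rpow_mul, ← ENNReal.rpow_mul, mul_comm q]
          ring
  have hsub : ∀ j ω, truncNormSum Xs {x | ‖x‖ ≤ v j} (2 ^ j) ω ^ q ≤
      ∑ i ∈ Finset.range (j + 1), truncNormSum Xs (normShell v i) (2 ^ j) ω ^ q := by
    intro j ω
    refine le_trans (ENNReal.rpow_le_rpow ?_ hq.le) (ENNReal.rpow_finsetSum_le hq hq1 _ _)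
    unfold truncNormSum
    rw [Finset.sum_comm]
    refine Finset.sum_le_sum fun k _ => ?_
    by_cases h : ‖Xs k ω‖ ≤ v j
    · obtain ⟨i, hij, hi⟩ := exists_mem_normShell h
      refine le_trans (le_of_eq ?_) (Finset.single_le_sum (fun _ _ => zero_le)
        (Finset.mem_range.2 (Nat.lt_succ_of_le hij)))
      rw [Set.indicator_of_mem hi, Set.indicator_of_mem (show Xs k ω ∈ {x | ‖x‖ ≤ v j} from h)]
    · rw [Set.indicator_of_notMem (show Xs k ω ∉ {x | ‖x‖ ≤ v j} from h)]; exact zero_le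
  have hx : r * 2 ^ q < 1 := by
    rw [hr, ← ENNReal.rpow_add _ _ (by simp) (by simp)]
    exact ENNReal.rpow_lt_one_of_one_lt_of_neg (by norm_num) (by linarith)
  calc ∑' j : ℕ, r ^ j * ∫⁻ ω, truncNormSum Xs {x | ‖x‖ ≤ v j} (2 ^ j) ω ^ q ∂μ
      ≤ ∑' j : ℕ, ∑' i : ℕ, if i ≤ j then 2 ^ q * g i * (r * 2 ^ q) ^ (j - i) else 0 := by
        refine ENNReal.tsum_le_tsum fun j => ?_
        refine le_trans ?_ (ENNReal.sum_le_tsum (Finset.range (j + 1)))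
        refine (mul_le_mul_right (lintegral_mono (hsub j)) _).trans ?_
        rw [lintegral_finsetSum _ fun i _ => (measurable_truncNormSum hXs
          (measurableSet_normShell v i) _).pow_const q, Finset.mul_sum]
        refine Finset.sum_le_sum fun i hi => ?_
        have hij : i ≤ j := Nat.lt_succ_iff.1 (Finset.mem_range.1 hi)
        rw [if_pos hij]
        have := hshell (j - i) i
        rwa [Nat.add_sub_cancel' hij] at this
    _ = ∑' i : ℕ, ∑' j : ℕ, if i ≤ j then 2 ^ q * g i * (r * 2 ^ q) ^ (j - i) else 0 :=
        ENNReal.tsum_comm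
    _ = ∑' i : ℕ, ∑' l : ℕ, 2 ^ q * g i * (r * 2 ^ q) ^ l := by
        refine tsum_congr fun i => ?_
        rw [← ENNReal.summable.sum_add_tsum_nat_add' (k := i), Finset.sum_eq_zero, zero_add]
        · simp
        · intro j hj
          rw [if_neg (not_le.2 (Finset.mem_range.1 hj))]
    _ = 2 ^ q * (∑' i, g i) * (1 - r * 2 ^ q)⁻¹ := by
        simp_rw [ENNReal.tsum_mul_left, ENNReal.tsum_mul_right, ENNReal.tsum_geometric]
        rw [ENNReal.tsum_mul_left]
    _ < ⊤ := by
        refine ENNReal.mul_lt_top (ENNReal.mul_lt_top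
          (ENNReal.rpow_lt_top_of_nonneg hq.le (by simp)) hsum) ?_
        exact (ENNReal.inv_ne_top.2 (tsub_pos_of_lt hx).ne').lt_top

/-- Dual to the small norms: the shells `i = j + l` lie above the cut, subadditivity is used instead
of Jensen, and the ratio is `2^{α-1}`, which is below one because `α < 1`. -/
theorem tsum_lintegral_truncNormSum_gt_lt_top [IsProbabilityMeasure μ] [MeasurableSpace B] [BorelSpace B]
    (hX : Measurable X)
    (hident : ∀ n, IdentDistrib (Xs n) X μ μ) (hXs : ∀ n, Measurable (Xs n)) {v : ℕ → ℝ}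
    (hvm : Monotone v)
    (hv : ∀ i, μ {ω | v i < ‖X ω‖} ≤ ((2 : ENNReal) ^ i)⁻¹)
    {q α : ℝ} (hq : 0 < q) (hq1 : q ≤ 1) (hα1 : α < 1)
    (hsum : ∑' i : ℕ, ((2 : ENNReal) ^ (-α)) ^ i * ENNReal.ofReal (v i) ^ q < ⊤) :
    ∑' j : ℕ, ((2 : ENNReal) ^ (-α)) ^ j *
      ∫⁻ ω, truncNormSum Xs {x | v j < ‖x‖} (2 ^ j) ω ^ q ∂μ < ⊤ := by
  set r : ENNReal := (2 : ENNReal) ^ (-α) with hr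
  set g : ℕ → ENNReal := fun i => r ^ i * ENNReal.ofReal (v i) ^ q with hg
  set y : ENNReal := (2 : ENNReal) ^ (α - 1) with hy
  have hy1 : y < 1 := ENNReal.rpow_lt_one_of_one_lt_of_neg (by norm_num) (by linarith)
  have hyr : y * r = 2⁻¹ := by
    rw [hy, hr, ← ENNReal.rpow_add _ _ (by simp) (by simp), ← ENNReal.rpow_neg_one]
    congr 1; ring
  -- The levels `v_i` may stay bounded, so the shells cover the values of `X` only up to a null set;
  -- the tail bounds `2^{-i}` show this.
  have hae : ∀ᵐ ω ∂μ, ∃ i, ‖X ω‖ ≤ v i := by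
    have h0 : ∀ i, μ {ω | ¬ ∃ i, ‖X ω‖ ≤ v i} ≤ ((2 : ENNReal)⁻¹) ^ i := fun i => by
      rw [← ENNReal.inv_pow]
      refine (measure_mono fun ω hω => ?_).trans (hv i)
      simp only [Set.mem_ofPred_eq, not_exists, not_le] at hω
      exact hω i
    have h1 := ge_of_tendsto' (ENNReal.tendsto_pow_atTop_nhds_zero_of_lt_one
      (r := 2⁻¹) (by norm_num)) h0
    exact le_antisymm h1 zero_le
  have hle : ∀ j, r ^ j * ∫⁻ ω, truncNormSum Xs {x | v j < ‖x‖} (2 ^ j) ω ^ q ∂μ ≤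
      ∑' l : ℕ, 2 * g (l + j) * y ^ l := by
    intro j
    have hgt : MeasurableSet {x : B | v j < ‖x‖} := measurableSet_lt measurable_const measurable_norm
    refine (mul_le_mul_right (lintegral_truncNormSum_rpow_le μ hident hXs hq hq1 hgt _) _).trans ?_
    have h1 : ∫⁻ ω, {x : B | v j < ‖x‖}.indicator (fun x => ‖x‖ₑ ^ q) (X ω) ∂μ ≤
        ∑' l : ℕ, ENNReal.ofReal (v (l + j)) ^ q * (2 * ((2 : ENNReal) ^ (l + j))⁻¹) := by
      calc _ ≤ ∫⁻ ω, ∑' l : ℕ, (normShell v (l + j)).indicator (fun x => ‖x‖ₑ ^ q) (X ω) ∂μ := by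
            refine lintegral_mono_ae (hae.mono fun ω hω => ?_)
            by_cases h : v j < ‖X ω‖
            · obtain ⟨m, hm⟩ := hω
              obtain ⟨i, -, hi⟩ := exists_mem_normShell hm
              have hji : j ≤ i := by
                by_contra hc
                have := hvm (not_le.1 hc).le
                exact absurd (norm_le_of_mem_normShell hi) (not_le.2 (this.trans_lt h))
              obtain ⟨l, rfl⟩ := Nat.exists_eq_add_of_le' hji
              refine le_trans (le_of_eq ?_) (ENNReal.le_tsum l)
              rw [Set.indicator_of_mem hi,
                Set.indicator_of_mem (show X ω ∈ {x | v j < ‖x‖} from h)]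
            · rw [Set.indicator_of_notMem (show X ω ∉ {x | v j < ‖x‖} from h)]; exact zero_le
        _ = ∑' l : ℕ, ∫⁻ ω, (normShell v (l + j)).indicator (fun x => ‖x‖ₑ ^ q) (X ω) ∂μ :=
            lintegral_tsum fun l => (((measurable_enorm.pow_const q).indicator
              (measurableSet_normShell v _)).comp hX).aemeasurable
        _ ≤ _ := ENNReal.tsum_le_tsum fun l =>
            (lintegral_indicator_enorm_rpow_le μ hq.le
              (fun x hx => norm_le_of_mem_normShell hx) (measurableSet_normShell v _) hX).trans
              (mul_le_mul_right (measure_preimage_normShell_le μ hv _) _)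
    refine (mul_le_mul_right (mul_le_mul_right h1 _) _).trans (le_of_eq ?_)
    rw [← ENNReal.tsum_mul_left, ← ENNReal.tsum_mul_left]
    refine tsum_congr fun l => ?_
    have e1 : ((2 : ENNReal) ^ (l + j))⁻¹ = (2 ^ l)⁻¹ * (2 ^ j)⁻¹ := by
      rw [pow_add, ENNReal.mul_inv (by simp) (by simp)]
    have e2 : ((2 : ENNReal) ^ l)⁻¹ = y ^ l * r ^ l := by
      rw [← mul_pow, hyr, ENNReal.inv_pow]
    rw [e1, e2, hg]
    push_cast
    calc _ = (2 ^ j * ((2 : ENNReal) ^ j)⁻¹) *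
          (r ^ j * (ENNReal.ofReal (v (l + j)) ^ q * (2 * (y ^ l * r ^ l)))) := by ring
      _ = _ := by
        rw [ENNReal.mul_inv_cancel (by simp) (by simp), one_mul, pow_add]
        ring
  calc _ ≤ ∑' j : ℕ, ∑' l : ℕ, 2 * g (l + j) * y ^ l := ENNReal.tsum_le_tsum hle
    _ = ∑' l : ℕ, ∑' j : ℕ, 2 * g (l + j) * y ^ l := ENNReal.tsum_comm
    _ ≤ ∑' l : ℕ, 2 * (∑' i, g i) * y ^ l := by
        refine ENNReal.tsum_le_tsum fun l => ?_
        rw [ENNReal.tsum_mul_right, ENNReal.tsum_mul_left]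
        exact mul_le_mul_left (mul_le_mul_right
          (ENNReal.tsum_comp_le_tsum_of_injective (add_right_injective l) g) _) _
    _ = 2 * (∑' i, g i) * (1 - y)⁻¹ := by rw [ENNReal.tsum_mul_left, ENNReal.tsum_geometric]
    _ < ⊤ := ENNReal.mul_lt_top (ENNReal.mul_lt_top (by simp) hsum)
        (ENNReal.inv_ne_top.2 (tsub_pos_of_lt hy1).ne').lt_top

end

/-! ### From dyadic scales to all indices -/

theorem tsum_slWeight_mul_log_le {α : ℝ} (hα : 0 ≤ α) (a : ℕ → ENNReal) :
    ∑' n : ℕ, slWeight α n * a (Nat.log 2 (n + 1)) ≤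
      ∑' j : ℕ, ((2 : ENNReal) ^ (-α)) ^ j * a j := by
  have h := tsum_succ_eq_tsum_sum_Ico_two_pow
    (fun n => ENNReal.ofReal ((n : ℝ) ^ (-(1 + α))) * a (Nat.log 2 n))
  refine (le_of_eq h).trans (ENNReal.tsum_le_tsum fun j => ?_)
  have hterm : ∀ n ∈ Finset.Ico (2 ^ j : ℕ) (2 ^ (j + 1)),
      ENNReal.ofReal ((n : ℝ) ^ (-(1 + α))) * a (Nat.log 2 n) ≤
        ENNReal.ofReal ((2 ^ j : ℝ) ^ (-(1 + α))) * a j := by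
    intro n hn
    rw [Finset.mem_Ico] at hn
    rw [Nat.log_eq_of_pow_le_of_lt_pow hn.1 hn.2]
    gcongr ENNReal.ofReal ?_ * _
    exact Real.rpow_le_rpow_of_nonpos (by positivity) (by exact_mod_cast hn.1) (by linarith)
  refine (Finset.sum_le_sum hterm).trans (le_of_eq ?_)
  have e : (2 ^ (j + 1) - 2 ^ j : ℕ) = 2 ^ j := by rw [pow_succ]; omega
  rw [Finset.sum_const, Nat.card_Ico, e, nsmul_eq_mul, ← mul_assoc, ← ENNReal.ofReal_natCast,
    ← ENNReal.ofReal_mul (by positivity)]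
  congr 1
  have e2 : (2 : ENNReal) ^ (-α) = ENNReal.ofReal ((2 : ℝ) ^ (-α)) := by
    rw [← ENNReal.ofReal_rpow_of_pos (by norm_num), ENNReal.ofReal_ofNat]
  rw [e2, ← ENNReal.ofReal_pow (by positivity)]
  congr 1
  push_cast
  rw [neg_add, Real.rpow_add (by positivity), Real.rpow_neg_one, ← mul_assoc,
    mul_inv_cancel₀ (by positivity), one_mul, ← Real.rpow_natCast 2 j,
    ← Real.rpow_natCast ((2 : ℝ) ^ (-α)) j, ← Real.rpow_mul (by norm_num),
    ← Real.rpow_mul (by norm_num), mul_comm]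

/-- An index `n + 1` is dominated by the next power of two, whence the shift by one scale; it costs
only the factor `2^α`. -/
theorem tsum_slWeight_mul_log_succ_lt_top {α : ℝ} (hα : 0 ≤ α) {a : ℕ → ENNReal}
    (h : ∑' j : ℕ, ((2 : ENNReal) ^ (-α)) ^ j * a j < ⊤) :
    ∑' n : ℕ, slWeight α n * a (Nat.log 2 (n + 1) + 1) < ⊤ := by
  set r : ENNReal := (2 : ENNReal) ^ (-α) with hr
  have hr0 : r ≠ 0 := (ENNReal.rpow_pos (by norm_num) (by simp)).ne'
  have hrt : r ≠ ⊤ := ENNReal.rpow_ne_top_of_ne_zero (by norm_num) (by simp)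
  refine (tsum_slWeight_mul_log_le hα fun j => a (j + 1)).trans_lt ?_
  calc ∑' j : ℕ, r ^ j * a (j + 1) = ∑' j : ℕ, r⁻¹ * (r ^ (j + 1) * a (j + 1)) := by
        refine tsum_congr fun j => ?_
        rw [pow_succ', mul_assoc, ← mul_assoc r⁻¹, ENNReal.inv_mul_cancel hr0 hrt, one_mul]
    _ = r⁻¹ * ∑' j : ℕ, r ^ (j + 1) * a (j + 1) := ENNReal.tsum_mul_left
    _ ≤ r⁻¹ * ∑' j : ℕ, r ^ j * a j := mul_le_mul_right
        (ENNReal.tsum_comp_le_tsum_of_injective (add_left_injective 1) fun j => r ^ j * a j) _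
    _ < ⊤ := ENNReal.mul_lt_top (ENNReal.inv_ne_top.2 hr0).lt_top h

theorem succ_le_two_pow_log_succ (n : ℕ) : n + 1 ≤ 2 ^ (Nat.log 2 (n + 1) + 1) :=
  (Nat.lt_pow_succ_log_self (by norm_num) _).le

section

variable {Ω : Type*} [MeasurableSpace Ω] (μ : Measure Ω) [IsProbabilityMeasure μ]
  {B : Type*} [NormedAddCommGroup B] [MeasurableSpace B] [BorelSpace B] {X : Ω → B}

theorem measure_normQuantile_two_pow_lt_le (hX : Measurable X) (i : ℕ) :
    μ {ω | normQuantile μ X (2 ^ i) < ‖X ω‖} ≤ ((2 : ENNReal) ^ i)⁻¹ := by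
  simpa using measure_normQuantile_lt_le μ hX (Nat.one_le_two_pow (n := i))

theorem tsum_normQuantile_two_pow_lt_top (hX : Measurable X) {q α : ℝ} (hq : 0 < q) (hα : 0 < α)
    (h : ∫⁻ t in Set.Ioi (0 : ℝ), μ {ω | t < ‖X ω‖ ^ q} ^ α < ⊤) :
    ∑' i : ℕ, ((2 : ENNReal) ^ (-α)) ^ i * ENNReal.ofReal (normQuantile μ X (2 ^ i)) ^ q < ⊤ := by
  refine (tsum_mul_enorm_rpow_le μ (fun i => normQuantile_nonneg μ Nat.one_le_two_pow X)
    (fun i t ht => ?_) hq hα).trans_lt (ENNReal.mul_lt_top ?_ h)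
  · simpa using le_measure_of_lt_normQuantile μ hX (Nat.one_le_two_pow (n := i)) ht
  · have : (2 : ENNReal) ^ (-α) < 1 :=
      ENNReal.rpow_lt_one_of_one_lt_of_neg (by norm_num) (by linarith)
    exact (ENNReal.inv_ne_top.2 (tsub_pos_of_lt this).ne').lt_top

end

/-! ### Sufficiency -/

theorem pqTypeSLLN_of_lintegral_rpow_lt_top
    {Ω : Type*} [MeasurableSpace Ω] (μ : Measure Ω) [IsProbabilityMeasure μ]
    {B : Type*} [NormedAddCommGroup B]
    [SecondCountableTopology B] [MeasurableSpace B] [BorelSpace B]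
    {p q : ℝ} (hq : 0 < q) (hqp : q < p) (hp : p < 1)
    {X : Ω → B} {Xs : ℕ → Ω → B}
    (hX : Measurable X) (hXs : ∀ n, Measurable (Xs n))
    (hident : ∀ n, IdentDistrib (Xs n) X μ μ)
    (h : ∫⁻ t in Set.Ioi (0 : ℝ), μ {ω | t < ‖X ω‖ ^ q} ^ (q / p) < ⊤) :
    PQTypeSLLN μ Xs p q := by
  have hp0 : 0 < p := hq.trans hqp
  have hq1 : q ≤ 1 := (hqp.trans hp).le
  set α := q / p with hα
  have hα0 : 0 < α := by positivity
  have hα1 : α < 1 := (div_lt_one hp0).2 hqp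
  -- This is `p < 1` in disguise: `q p < q`.
  have hqα : q < α := by rw [hα, lt_div_iff₀ hp0]; nlinarith
  rw [pqTypeSLLN_iff]
  set v : ℕ → ℝ := fun i => normQuantile μ X (2 ^ i) with hvdef
  have hv := measure_normQuantile_two_pow_lt_le μ hX
  have hvm : Monotone v := fun i j hij => normQuantile_mono μ hX Nat.one_le_two_pow
    (Nat.pow_le_pow_right (by norm_num) hij)
  have hsum := tsum_normQuantile_two_pow_lt_top μ hX hq hα0 h
  have hsmall := tsum_lintegral_truncNormSum_le_lt_top μ hX hident hXs hv hq hq1 hqα hsum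
  have hlarge := tsum_lintegral_truncNormSum_gt_lt_top μ hX hident hXs hvm hv hq hq1 hα1 hsum
  have hSm : ∀ n, Measurable fun ω => ‖partialSum Xs n ω‖ ^ q := fun n =>
    (Measurable.norm (Finset.measurable_fun_sum _ fun i _ => hXs i)).pow_const q
  have hle : ∀ j, MeasurableSet {x : B | ‖x‖ ≤ v j} := fun j =>
    measurableSet_le measurable_norm measurable_const
  have hgt : ∀ j, MeasurableSet {x : B | v j < ‖x‖} := fun j =>
    measurableSet_lt measurable_const measurable_norm
  have hsum2 := ENNReal.add_lt_top.2 ⟨hsmall, hlarge⟩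
  rw [← ENNReal.tsum_add] at hsum2
  simp_rw [← mul_add] at hsum2
  refine ae_lt_top (Measurable.tsum fun n => (hSm (n + 1)).ennreal_ofReal.const_mul _)
    (ne_of_lt (lt_of_le_of_lt ?_ (tsum_slWeight_mul_log_succ_lt_top hα0.le hsum2)))
  rw [lintegral_tsum fun n => ((hSm (n + 1)).ennreal_ofReal.const_mul _).aemeasurable]
  refine ENNReal.tsum_le_tsum fun n => ?_
  rw [lintegral_const_mul _ (hSm (n + 1)).ennreal_ofReal]
  gcongr
  set j := Nat.log 2 (n + 1) + 1
  rw [← lintegral_add_left ((measurable_truncNormSum hXs (hle j) _).pow_const q)]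
  refine lintegral_mono fun ω => ?_
  rw [ofReal_norm_rpow hq.le]
  refine le_trans (ENNReal.rpow_le_rpow ?_ hq.le) (ENNReal.rpow_add_le_add_rpow _ _ hq.le hq1)
  refine (enorm_partialSum_le_truncNormSum_univ Xs (n + 1) ω).trans
    (le_trans (truncNormSum_mono Xs ?_ (succ_le_two_pow_log_succ n) ω)
      (truncNormSum_union_le Xs _ _ _ ω))
  intro x _
  exact le_or_gt ‖x‖ (v j)

theorem ae_eventually_norm_rpow_le {Ω : Type*} [MeasurableSpace Ω] (μ : Measure Ω)
    [IsProbabilityMeasure μ] {B : Type*} [NormedAddCommGroup B] [MeasurableSpace B] [BorelSpace B]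
    {p : ℝ} {X : Ω → B} {Xs : ℕ → Ω → B} (hident : ∀ n, IdentDistrib (Xs n) X μ μ)
    (hint : Integrable (fun ω => ‖X ω‖ ^ p) μ) :
    ∀ᵐ ω ∂μ, ∀ᶠ n : ℕ in Filter.atTop, ∀ k ≤ n, ‖Xs k ω‖ ^ p ≤ ((n + 1 : ℕ) : ℝ) := by
  -- `tsum_prob_mem_Ioi_lt_top` is stated for the canonical volume, so `μ` is installed as such.
  let : MeasureSpace Ω := ⟨μ⟩
  have hsum := tsum_prob_mem_Ioi_lt_top hint (fun ω => by positivity)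
  have hmq : Measurable fun x : B => ‖x‖ ^ p := by fun_prop
  have hsum' : ∑' k : ℕ, μ {ω | (k : ℝ) < ‖Xs k ω‖ ^ p} ≠ ⊤ := by
    refine ne_of_lt (lt_of_le_of_lt (ENNReal.tsum_le_tsum fun k => le_of_eq ?_) hsum)
    exact (hident k).measure_mem_eq (s := {x : B | (k : ℝ) < ‖x‖ ^ p})
      (measurableSet_lt measurable_const hmq)
  filter_upwards [ae_eventually_notMem hsum'] with ω hω
  obtain ⟨K, hK⟩ := Filter.eventually_atTop.1 hω
  have hfin : ∀ᶠ n : ℕ in Filter.atTop, ∀ k ∈ Finset.range K,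
      ‖Xs k ω‖ ^ p ≤ ((n + 1 : ℕ) : ℝ) := by
    rw [Filter.eventually_all_finset]
    intro k _
    obtain ⟨N, hN⟩ := exists_nat_ge (‖Xs k ω‖ ^ p)
    filter_upwards [Filter.eventually_ge_atTop N] with n hn
    exact hN.trans (by exact_mod_cast hn.trans (Nat.le_succ n))
  filter_upwards [hfin] with n hn k hk
  by_cases hkK : k < K
  · exact hn k (Finset.mem_range.2 hkK)
  · have h1 : ‖Xs k ω‖ ^ p ≤ k := not_lt.1 (hK k (not_lt.1 hkK))
    exact h1.trans (by exact_mod_cast hk.trans (Nat.le_succ n))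

/-- The part below the quantile and the middle part have weighted expectations with finite sum, so
their series converge almost surely. The part with `‖x‖^p` above the index has no such bound and is
treated pathwise. -/
theorem pqTypeSLLN_of_integrable_of_summable
    {Ω : Type*} [MeasurableSpace Ω] (μ : Measure Ω) [IsProbabilityMeasure μ]
    {B : Type*} [NormedAddCommGroup B]
    [SecondCountableTopology B] [MeasurableSpace B] [BorelSpace B]
    {p : ℝ} (hp0 : 0 < p) (hp : p < 1)
    {X : Ω → B} {Xs : ℕ → Ω → B}
    (hX : Measurable X) (hXs : ∀ n, Measurable (Xs n))
    (hident : ∀ n, IdentDistrib (Xs n) X μ μ)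
    (hint : Integrable (fun ω => ‖X ω‖ ^ p) μ)
    (hτ : Summable fun n : ℕ => truncatedMoment μ X p (n + 1) / ((n + 1 : ℕ) : ℝ)) :
    PQTypeSLLN μ Xs p p := by
  rw [pqTypeSLLN_iff, div_self hp0.ne']
  have hmq : Measurable fun x : B => ‖x‖ ^ p := by fun_prop
  have htail : ∫⁻ t in Set.Ioi (0 : ℝ), μ {ω | t < ‖X ω‖ ^ p} ^ (1 : ℝ) < ⊤ := by
    simp only [ENNReal.rpow_one]
    rw [← lintegral_eq_lintegral_meas_lt μ (Filter.Eventually.of_forall fun ω => by positivity)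
      hint.aestronglyMeasurable.aemeasurable]
    exact (hasFiniteIntegral_iff_ofReal (Filter.Eventually.of_forall fun ω => by positivity)).1
      hint.hasFiniteIntegral
  set v : ℕ → ℝ := fun i => normQuantile μ X (2 ^ i) with hvdef
  have hsmall := tsum_lintegral_truncNormSum_le_lt_top μ hX hident hXs
    (measure_normQuantile_two_pow_lt_le μ hX) hp0 hp.le hp
    (tsum_normQuantile_two_pow_lt_top μ hX hp0 one_pos htail)
  set s₁ : ℕ → Set B := fun n => {x | ‖x‖ ≤ normQuantile μ X (n + 1)} with hs₁
  set s₂ : ℕ → Set B := fun n => {x | min (normQuantile μ X (n + 1) ^ p) ((n + 1 : ℕ) : ℝ) <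
    ‖x‖ ^ p ∧ ‖x‖ ^ p ≤ ((n + 1 : ℕ) : ℝ)} with hs₂
  set s₃ : ℕ → Set B := fun n => {x | ((n + 1 : ℕ) : ℝ) < ‖x‖ ^ p} with hs₃
  have hs₁m : ∀ n, MeasurableSet (s₁ n) := fun n => measurableSet_le measurable_norm measurable_const
  have hs₂m : ∀ n, MeasurableSet (s₂ n) := fun n =>
    (measurableSet_lt measurable_const hmq).inter (measurableSet_le hmq measurable_const)
  have hm : ∀ s : ℕ → Set B, (∀ n, MeasurableSet (s n)) → ∀ n,
      Measurable fun ω => truncNormSum Xs (s n) (n + 1) ω ^ p := fun s hs n =>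
    (measurable_truncNormSum hXs (hs n) _).pow_const p
  have h₁ : ∑' n : ℕ, slWeight 1 n * ∫⁻ ω, truncNormSum Xs (s₁ n) (n + 1) ω ^ p ∂μ < ⊤ := by
    refine lt_of_le_of_lt (ENNReal.tsum_le_tsum fun n => ?_)
      (tsum_slWeight_mul_log_succ_lt_top zero_le_one hsmall)
    gcongr with ω
    refine truncNormSum_mono Xs (fun x hx => ?_) (succ_le_two_pow_log_succ n) ω
    exact le_trans hx (normQuantile_mono μ hX (Nat.le_add_left 1 n) (succ_le_two_pow_log_succ n))
  have h₂ : ∑' n : ℕ, slWeight 1 n * ∫⁻ ω, truncNormSum Xs (s₂ n) (n + 1) ω ^ p ∂μ < ⊤ := by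
    have h0 : ∀ n, 0 ≤ truncatedMoment μ X p n := fun n =>
      integral_nonneg fun ω => Set.indicator_nonneg (fun ω _ => by positivity) ω
    have hlt : ∑' n : ℕ, ENNReal.ofReal (truncatedMoment μ X p (n + 1) / ((n + 1 : ℕ) : ℝ)) < ⊤ := by
      rw [← ENNReal.ofReal_tsum_of_nonneg (fun n => div_nonneg (h0 _) (by positivity)) hτ]
      exact ENNReal.ofReal_lt_top
    refine lt_of_le_of_lt (ENNReal.tsum_le_tsum fun n => ?_) hlt
    -- Subadditivity gives `n + 1` times the truncated moment, which against the weight `(n+1)^{-2}`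
    -- is exactly the term of the assumed series.
    have h3 := lintegral_truncNormSum_rpow_le μ hident hXs hp0 hp.le (hs₂m n) (n + 1)
    have h4 : ∫⁻ ω, (s₂ n).indicator (fun x => ‖x‖ₑ ^ p) (X ω) ∂μ =
        ENNReal.ofReal (truncatedMoment μ X p (n + 1)) := by
      rw [ofReal_truncatedMoment μ hX p]
      refine lintegral_congr fun ω => ?_
      by_cases hω : X ω ∈ s₂ n
      · rw [Set.indicator_of_mem hω, ← ofReal_norm_rpow hp0.le]
        refine congrArg ENNReal.ofReal (Eq.symm (Set.indicator_of_mem ?_ _))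
        exact hω
      · rw [Set.indicator_of_notMem hω, ← ENNReal.ofReal_zero]
        refine congrArg ENNReal.ofReal (Eq.symm (Set.indicator_of_notMem ?_ _))
        exact hω
    rw [h4] at h3
    refine (mul_le_mul_right h3 _).trans (le_of_eq ?_)
    rw [slWeight, ← ENNReal.ofReal_natCast, ← ENNReal.ofReal_mul (by positivity),
      ← ENNReal.ofReal_mul (by positivity)]
    congr 1
    rw [Real.rpow_neg (by positivity)]
    norm_num
    field_simp
  have hae : ∀ s : ℕ → Set B, (∀ n, MeasurableSet (s n)) →
      ∑' n : ℕ, slWeight 1 n * ∫⁻ ω, truncNormSum Xs (s n) (n + 1) ω ^ p ∂μ < ⊤ →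
      ∀ᵐ ω ∂μ, ∑' n : ℕ, slWeight 1 n * truncNormSum Xs (s n) (n + 1) ω ^ p < ⊤ := by
    intro s hs hlt
    refine ae_lt_top (Measurable.tsum fun n => (hm s hs n).const_mul _) (ne_of_lt ?_)
    rw [lintegral_tsum fun n => ((hm s hs n).const_mul _).aemeasurable]
    simp_rw [lintegral_const_mul _ (hm s hs _)]
    exact hlt
  filter_upwards [hae s₁ hs₁m h₁, hae s₂ hs₂m h₂, ae_eventually_norm_rpow_le μ hident hint]
    with ω hω₁ hω₂ hω₃
  have h₃ : ∑' n : ℕ, slWeight 1 n * truncNormSum Xs (s₃ n) (n + 1) ω ^ p < ⊤ := by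
    obtain ⟨N, hN⟩ := Filter.eventually_atTop.1 hω₃
    -- For this `ω` no summand among the first `n + 1` has `p`-th power above `n + 1` once `n ≥ N`,
    -- so the series is a finite sum of finite terms.
    rw [tsum_eq_sum (s := Finset.range N)]
    · refine ENNReal.sum_lt_top.2 fun n _ => ENNReal.mul_lt_top ENNReal.ofReal_lt_top
        (ENNReal.rpow_lt_top_of_nonneg hp0.le ?_)
      refine (ENNReal.sum_lt_top.2 fun k _ => ?_).ne
      exact (Set.indicator_le_self _ _ _).trans_lt enorm_lt_top
    · intro n hn
      have h0 : truncNormSum Xs (s₃ n) (n + 1) ω = 0 := by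
        refine Finset.sum_eq_zero fun k hk => Set.indicator_of_notMem ?_ _
        exact not_lt.2 (hN n (by simpa using hn) k (Nat.lt_succ_iff.1 (Finset.mem_range.1 hk)))
      rw [h0, ENNReal.zero_rpow_of_pos hp0, mul_zero]
  have htot := ENNReal.add_lt_top.2 ⟨ENNReal.add_lt_top.2 ⟨hω₁, hω₂⟩, h₃⟩
  rw [← ENNReal.tsum_add, ← ENNReal.tsum_add] at htot
  refine lt_of_le_of_lt (ENNReal.tsum_le_tsum fun n => ?_) htot
  rw [← mul_add, ← mul_add, ofReal_norm_rpow hp0.le]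
  gcongr
  have hcover : truncNormSum Xs Set.univ (n + 1) ω ≤ truncNormSum Xs (s₁ n) (n + 1) ω +
      truncNormSum Xs (s₂ n) (n + 1) ω + truncNormSum Xs (s₃ n) (n + 1) ω := by
    have hsub : Set.univ ⊆ s₁ n ∪ s₂ n ∪ s₃ n := by
      intro x _
      by_cases hx₁ : ‖x‖ ≤ normQuantile μ X (n + 1)
      · exact Or.inl (Or.inl hx₁)
      by_cases hx₃ : ((n + 1 : ℕ) : ℝ) < ‖x‖ ^ p
      · exact Or.inr hx₃
      refine Or.inl (Or.inr ⟨min_lt_iff.2 (Or.inl ?_), not_lt.1 hx₃⟩)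
      exact Real.rpow_lt_rpow (normQuantile_nonneg μ (Nat.le_add_left 1 n) X) (not_le.1 hx₁) hp0
    exact (truncNormSum_mono Xs hsub le_rfl ω).trans ((truncNormSum_union_le Xs _ _ _ ω).trans
      (add_le_add_left (truncNormSum_union_le Xs _ _ _ ω) _))
  refine (ENNReal.rpow_le_rpow ((enorm_partialSum_le_truncNormSum_univ Xs (n + 1) ω).trans hcover)
    hp0.le).trans ((ENNReal.rpow_add_le_add_rpow _ _ hp0.le hp.le).trans ?_)
  exact add_le_add_left (ENNReal.rpow_add_le_add_rpow _ _ hp0.le hp.le) _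

/-! ### The equivalence -/

theorem mainTheorem2
    {Ω : Type*} [MeasurableSpace Ω] (μ : Measure Ω) [IsProbabilityMeasure μ]
    {B : Type*} [NormedAddCommGroup B] [NormedSpace ℝ B] [CompleteSpace B]
    [TopologicalSpace.SeparableSpace B] [MeasurableSpace B] [BorelSpace B]
    (p q : ℝ) (hq : 0 < q) (hqp : q ≤ p) (hp : p < 1)
    (X : Ω → B) (Xs : ℕ → Ω → B)
    (hX : Measurable X) (hXs : ∀ n, Measurable (Xs n))
    (hindep : iIndepFun Xs μ) (hident : ∀ n, IdentDistrib (Xs n) X μ μ) :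
    PQTypeSLLN μ Xs p q ↔
      ((q < p → ∫⁻ t in Set.Ioi (0 : ℝ), (μ {ω | t < ‖X ω‖ ^ q}) ^ (q / p) < ⊤) ∧
        (q = p →
          Integrable (fun ω => ‖X ω‖ ^ p) μ ∧
            Summable fun n : ℕ => truncatedMoment μ X p (n + 1) / ((n + 1 : ℕ) : ℝ))) := by
  have : SecondCountableTopology B := UniformSpace.secondCountable_of_separable B
  have hp0 : 0 < p := hq.trans_le hqp
  constructor
  · intro h
    refine ⟨fun _ => lintegral_rpow_lt_top_of_pqTypeSLLN μ hq (hqp.trans hp.le) hp0 hX hXs hindep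
      hident h, fun hpq => ?_⟩
    subst hpq
    exact integrable_and_summable_of_pqTypeSLLN μ hq hp.le hX hXs hindep hident h
  · rintro ⟨h1, h2⟩
    rcases hqp.lt_or_eq with hlt | rfl
    · exact pqTypeSLLN_of_lintegral_rpow_lt_top μ hq hlt hp hX hXs hident (h1 hlt)
    · exact pqTypeSLLN_of_integrable_of_summable μ hq hp hX hXs hident (h2 rfl).1 (h2 rfl).2
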